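/- Let $N\ge 1$ and let $U$ be the unitary $N\times N$ DFT matrix. Let $P\in\mathbb C^{N\times N}$ be an antenna weight matrix that illuminates the sector $\mathcal A=\{(p,q):(U^*PU^*)_{pq}\ne 0\}$ (indices $0,\dots,N-1$), and assume that $|\mathcal A|=N^2/S$ with a positive integer $S$. Let $P_{\mathrm{FC}}(i,j)=\overline{P(-i,-j)}$ (indices modulo $N$), let $Z=N\,U^*P_{\mathrm{FC}}U^*$ be the spectral mask, and $z=\mathrm{vec}(Z)$. For $M$ circular shifts $(r[m],c[m])\in\{0,\dots,N-1\}^2$, let $\mathbf S$ be the $M\times N^2$ matrix whose $m$-th row is $1$ at position $Nc[m]+r[m]$ and $0$ elsewhere, and let $A_{\mathrm o}=\mathbf S(U\otimes U)\,\mathrm{Diag}(z)$. Let $X\in\mathbb C^{N\times N}$ be the beamspace matrix and suppose that $$y=A_{\mathrm o}\,\mathrm{vec}(X)+v,$$ where the entries of $v$ are independent circularly symmetric complex Gaussians $\mathcal{CN}(0,\sigma^2)$, $\sigma>0$. Let $\mathcal L=\{qN+p:(p,q)\in\mathcal A\}$, let $A$ be the $M\times N^2/S$ submatrix of $A_{\mathrm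 o}$ formed by the columns indexed by $\mathcal L$, and let $x$ be the subvector of $\mathrm{vec}(X)$ with indices in $\mathcal L$, so that $y=Ax+v$. Let $d_{\min}$ and $d_{\max}$ be the smallest and the largest $\ell_2$-norm of a column $a_j$ of $A$, let $\mu=\max_{i\ne j}|a_i^*a_j|/(\|a_i\|_2\|a_j\|_2)$ be the mutual coherence of $A$, let $\Pi$ be the support of $x$, $k=|\Pi|\ge 1$, and $x_{\min}=\min_{j\in\Pi}|x_j|$. Orthogonal matching pursuit (OMP) starts from the empty index set and the zero estimate. In each iteration it adds to the index set an index $j$ that maximizes $|a_j^*\,r|/\|a_j\|_2$, where $r$ is the current residual ($y$ minus $A$ times the current estimate), with arbitrary tie-breaking, and replaces the estimate by a least-squares fit of $y$ supported on the new index set. It stops after $k$ iterations and returns the index set and the estimate $\hat x$. **Theorem.** Suppose that $\gamma>0$ and $$d_{\min}x_{\min}-(2k-1)\,\mu\, d_{\max}x_{\min}\ \ge\ 2\gamma .$$ Then there is an event $E$ with $$\Pr(E)\ \ge\ \left(\max\left\{0,\;1-\sqrt{\tfrac{2}{\pi}}\,\sqrt{\tfrac{\sigma}{\gamma}}\;\exp\!\left(-\tfrac{\gamma^2}{2\sigma^2}\right)\right\}\right)^{2N^2/S}$$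 such that on $E$ OMP returns exactly the support $\Pi$ of $x$, and its estimate satisfies $$\|\hat x-x\|_2^2\ \le\ \left(\frac{d_{\max}}{d_{\min}}\right)^{2}\frac{k\gamma^2}{\bigl(d_{\min}-(k-1)\mu d_{\max}\bigr)^2}.$$ -/

import Mathlib

open MeasureTheory ProbabilityTheory
open scoped Kronecker Matrix

namespace InSector

/-! ### Sparse recovery: column norms, coherence, orthogonal matching pursuit -/

section OMP

variable {κ ι : Type*} [Fintype κ] [Fintype ι]

/-- The Euclidean norm of a complex vector. -/
noncomputable def l2norm {α : Type*} [Fintype α] (u : α → ℂ) : ℝ := ‖WithLp.toLp 2 u‖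

/-- The Euclidean norm of the `j`-th column of `A`. -/
noncomputable def colNorm (A : Matrix κ ι ℂ) (j : ι) : ℝ := l2norm (A.col j)

/-- The largest column norm of `A`. -/
noncomputable def dMax (A : Matrix κ ι ℂ) : ℝ := ⨆ j, colNorm A j

/-- The smallest column norm of `A`. -/
noncomputable def dMin (A : Matrix κ ι ℂ) : ℝ := ⨅ j, colNorm A j

/-- The mutual coherence of `A`: the largest modulus of a normalized inner product of two distinct
columns (`0` if there is only one column). -/
noncomputable def coherence (A : Matrix κ ι ℂ) : ℝ :=
  ⨆ p : {p : ι × ι // p.1 ≠ p.2},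
    ‖star (A.col p.1.1) ⬝ᵥ A.col p.1.2‖ / (colNorm A p.1.1 * colNorm A p.1.2)

/-- The set of indices of the nonzero entries of `x`. -/
noncomputable def supp (x : ι → ℂ) : Finset ι :=
  open Classical in Finset.univ.filter fun j => x j ≠ 0

/-- The smallest modulus of an entry of `x` on its support. -/
noncomputable def xMin (x : ι → ℂ) : ℝ := ⨅ j : supp x, ‖x j‖

/-- `z` is a least-squares solution of `y ≈ A z` among the vectors supported in `Λ`. -/
def IsLeastSquaresOn (A : Matrix κ ι ℂ) (y : κ → ℂ) (Λ : Finset ι) (z : ι → ℂ) : Prop :=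
  (∀ j, j ∉ Λ → z j = 0) ∧
    ∀ w : ι → ℂ, (∀ j, j ∉ Λ → w j = 0) → l2norm (y - A *ᵥ z) ≤ l2norm (y - A *ᵥ w)

/-- The modulus of the inner product of the residual `res` with the normalized `j`-th column. -/
noncomputable def correlation (A : Matrix κ ι ℂ) (res : κ → ℂ) (j : ι) : ℝ :=
  ‖star (A.col j) ⬝ᵥ res‖ / colNorm A j

/-- `OMPState A y t Λ z`: after `t` iterations, a run of orthogonal matching pursuit on the data
`A`, `y` can have selected the index set `Λ` and have the estimate `z`. Each iteration adds an index
whose normalized column is most correlated with the current residual (ties broken arbitrarily) and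
recomputes the estimate by least squares on the selected columns. -/
inductive OMPState [DecidableEq ι] (A : Matrix κ ι ℂ) (y : κ → ℂ) :
    ℕ → Finset ι → (ι → ℂ) → Prop
  | init : OMPState A y 0 ∅ 0
  | step {t : ℕ} {Λ : Finset ι} {z z' : ι → ℂ} {j : ι} (prev : OMPState A y t Λ z)
      (select : ∀ i, correlation A (y - A *ᵥ z) i ≤ correlation A (y - A *ᵥ z) j)
      (update : IsLeastSquaresOn A y (insert j Λ) z') :
      OMPState A y (t + 1) (insert j Λ) z'

/-- Least-squares solutions always exist. -/
theorem exists_isLeastSquaresOn (A : Matrix κ ι ℂ) (y : κ → ℂ) (Λ : Finset ι) :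
    ∃ z, IsLeastSquaresOn A y Λ z := by
  classical
  let V : Submodule ℂ (ι → ℂ) :=
    { carrier := {w | ∀ j, j ∉ Λ → w j = 0}
      add_mem' := fun {a b} ha hb j hj => by simp [ha j hj, hb j hj]
      zero_mem' := fun j _ => rfl
      smul_mem' := fun c a ha j hj => by simp [ha j hj] }
  let f : (ι → ℂ) →ₗ[ℂ] EuclideanSpace ℂ κ :=
    (WithLp.linearEquiv 2 ℂ (κ → ℂ)).symm.toLinearMap ∘ₗ A.mulVecLin
  let K : Submodule ℂ (EuclideanSpace ℂ κ) := V.map f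
  obtain ⟨p, hp, hmin⟩ := K.exists_norm_eq_iInf_of_complete_subspace
    (completeSpace_coe_iff_isComplete.mp (FiniteDimensional.complete ℂ K)) (WithLp.toLp 2 y)
  obtain ⟨z, hz, rfl⟩ := hp
  refine ⟨z, hz, fun w hw => ?_⟩
  have hle : ‖WithLp.toLp 2 y - f z‖ ≤ ‖WithLp.toLp 2 y - f w‖ := by
    rw [hmin]
    exact ciInf_le ⟨0, by rintro _ ⟨q, rfl⟩; exact norm_nonneg _⟩
      (⟨f w, ⟨w, hw, rfl⟩⟩ : K)
  exact hle

/-- Orthogonal matching pursuit can always be run for any number of iterations. -/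
theorem exists_ompState [DecidableEq ι] [Nonempty ι] (A : Matrix κ ι ℂ) (y : κ → ℂ) (t : ℕ) :
    ∃ Λ z, OMPState A y t Λ z := by
  induction t with
  | zero => exact ⟨∅, 0, .init⟩
  | succ t ih =>
    obtain ⟨Λ, z, h⟩ := ih
    obtain ⟨j, hj⟩ := Finite.exists_max (correlation A (y - A *ᵥ z))
    obtain ⟨z', hz'⟩ := exists_isLeastSquaresOn A y (insert j Λ)
    exact ⟨_, z', .step h hj hz'⟩

end OMP

/-! ### The in-sector measurement model -/

section Model

variable {N M : ℕ}

/-- The unitary `N × N` discrete Fourier transform matrix. -/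
noncomputable def dft (N : ℕ) : Matrix (Fin N) (Fin N) ℂ :=
  Matrix.of fun j k =>
    ((1 / Real.sqrt N : ℝ) : ℂ) *
      Complex.exp (-(2 * Real.pi * Complex.I * ((j : ℕ) : ℂ) * ((k : ℕ) : ℂ) / (N : ℂ)))

/-- The sector illuminated by the antenna weight matrix `P`: the set of beamspace indices `(p, q)`
at which the inverse 2D discrete Fourier transform of `P` does not vanish. -/
noncomputable def sector (P : Matrix (Fin N) (Fin N) ℂ) : Finset (Fin N × Fin N) :=
  open Classical in Finset.univ.filter fun l => ((dft N)ᴴ * P * (dft N)ᴴ) l.1 l.2 ≠ 0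

/-- The flipped (`i ↦ -i` modulo `N`, in both directions) and conjugated version of `P`. -/
def flipConj [NeZero N] (P : Matrix (Fin N) (Fin N) ℂ) : Matrix (Fin N) (Fin N) ℂ :=
  Matrix.of fun i j => star (P (-i) (-j))

/-- The spectral mask of the antenna weight matrix `P`. -/
noncomputable def spectralMask [NeZero N] (P : Matrix (Fin N) (Fin N) ℂ) :
    Matrix (Fin N) (Fin N) ℂ :=
  (N : ℂ) • ((dft N)ᴴ * flipConj P * (dft N)ᴴ)

/-- The 0-1 matrix that picks the entries at the positions `(r m, c m)` of a column-stacked matrix.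
The entry at row `p` and column `q` of a matrix has the index `(q, p)` in its vector version. -/
def subsampling (r c : Fin M → Fin N) : Matrix (Fin M) (Fin N × Fin N) ℂ :=
  Matrix.of fun m l => if l = (c m, r m) then 1 else 0

/-- The compressed sensing matrix of the circular shifts `(r m, c m)` of `P`. -/
noncomputable def csMatrix [NeZero N] (P : Matrix (Fin N) (Fin N) ℂ) (r c : Fin M → Fin N) :
    Matrix (Fin M) (Fin N × Fin N) ℂ :=
  subsampling r c * (dft N ⊗ₖ dft N) * Matrix.diagonal (spectralMask P).vec

/-- The positions, in vectorized matrices, of the entries in the sector illuminated by `P`. -/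
noncomputable def sectorIndices (P : Matrix (Fin N) (Fin N) ℂ) : Finset (Fin N × Fin N) :=
  Finset.univ.filter fun l => (l.2, l.1) ∈ sector P

/-- The columns of the compressed sensing matrix that belong to the sector. -/
noncomputable def inSectorMatrix [NeZero N] (P : Matrix (Fin N) (Fin N) ℂ)
    (r c : Fin M → Fin N) : Matrix (Fin M) (sectorIndices P) ℂ :=
  (csMatrix P r c).submatrix id Subtype.val

/-- The entries of the vectorized beamspace matrix `X` that belong to the sector. -/
def inSectorVector (P X : Matrix (Fin N) (Fin N) ℂ) : sectorIndices P → ℂ :=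
  fun l => X.vec l

/-- The circularly symmetric complex Gaussian distribution with mean `0` and variance `s`. -/
noncomputable def complexGaussian (s : NNReal) : Measure ℂ :=
  ((gaussianReal 0 (s / 2)).prod (gaussianReal 0 (s / 2))).map fun p => ⟨p.1, p.2⟩

end Model

end InSector

/-!
The support recovery is deterministic on the event that every normalized column of `A` has an inner
product of modulus less than `γ` with the noise (`OMPState.eq_supp_and_l2norm_le`). On that event,
at each iteration, the entry of the current error with the largest weighted modulus
`‖u i‖ * colNorm A i` produces a correlation with the residual that exceeds, by the coherence
condition, every correlation outside the support (`mem_of_forall_correlation_le`), and columns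
selected before are orthogonal to the residual. So `k` iterations select exactly the support, and
the error solves the normal equations with the noise on the right-hand side; the Gram matrix of the
normalized columns is diagonally dominant, which bounds the largest entry of the error
(`norm_mul_colNorm_le_of_orthogonal`). The measurements reduce to `A *ᵥ x` plus noise because the
spectral mask vanishes outside the sector (`csMatrix_mulVec_vec`).

For the probability, the event contains an intersection of two slabs for each column, one for the
real and one for the imaginary part of the inner product, which are correlated centered Gaussians of
variance `σ ^ 2 / 2`. Šidák's inequality (`prod_measure_slab_le`) bounds the probability of the
intersection from below by the product of the probabilities of the slabs, and each factor is bounded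
by a Gaussian tail estimate that holds at all heights (`integral_Ioi_exp_le`).

Šidák's inequality follows by induction from the positive correlation of a slab with a symmetric
convex set `K` (`measure_slab_mul_le`). Decompose a Gaussian vector as `l x • e` plus a remainder
independent of `l x`. Given `l x = u`, the probability of `K` is the measure of a translate of `K`
under the law of the remainder; it is even in `u` and decreases in `|u|`, by the Prékopa-Leindler
inequality, which passes from the line to products and linear images (`PrekopaLeindler`).
-/

namespace InSector

/-! ### The Prékopa-Leindler inequality on the line -/

section Line

open Set ENNReal
open scoped Pointwise

/-- The one-dimensional Brunn-Minkowski inequality. For compact `A` and `B` the sum set contains the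
translates `A + min B` and `max A + B`, which have a single point in common. -/
theorem volume_add_volume_le {A B C : Set ℝ} (hA : MeasurableSet A) (hB : MeasurableSet B)
    (hA' : A.Nonempty) (hB' : B.Nonempty) (h : ∀ x ∈ A, ∀ y ∈ B, x + y ∈ C) :
    volume A + volume B ≤ volume C := by
  have key : ∀ K L : Set ℝ, IsCompact K → IsCompact L → K.Nonempty → L.Nonempty →
      K ⊆ A → L ⊆ B → volume K + volume L ≤ volume C := by
    intro K L hK hL hK' hL' hKA hLB
    have hα := hK.sSup_mem hK'
    have hβ := hL.sInf_mem hL'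
    set α := sSup K
    set β := sInf L
    have h1 : volume ((· + β) '' K) = volume K := by
      rw [image_add_right, measure_preimage_add_right]
    have h2 : volume ((α + ·) '' L) = volume L := by
      rw [image_add_left, measure_preimage_add]
    rw [← h1, ← h2, ← measure_union₀]
    · refine measure_mono ?_
      rintro _ (⟨x, hx, rfl⟩ | ⟨y, hy, rfl⟩)
      · exact h _ (hKA hx) _ (hLB hβ)
      · exact h _ (hKA hα) _ (hLB hy)
    · exact (hL.image (by fun_prop)).measurableSet.nullMeasurableSet
    · refine measure_mono_null (t := {α + β}) ?_ (by simp)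
      rintro _ ⟨⟨x, hx, rfl⟩, ⟨y, hy, hxy⟩⟩
      have h3 : x ≤ α := le_csSup hK.bddAbove hx
      have h4 : β ≤ y := csInf_le hL.bddBelow hy
      simp only [mem_singleton_iff] at *
      linarith
  obtain ⟨a, ha⟩ := hA'
  obtain ⟨b, hb⟩ := hB'
  rw [hA.measure_eq_iSup_isCompact, hB.measure_eq_iSup_isCompact]
  simp_rw [iSup_and']
  refine ENNReal.biSup_add_biSup_le' ⟨∅, by simp⟩ ⟨∅, by simp⟩ ?_
  rintro K ⟨hKA, hK⟩ L ⟨hLB, hL⟩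
  calc volume K + volume L ≤ volume (insert a K) + volume (insert b L) :=
        add_le_add (measure_mono (subset_insert _ _)) (measure_mono (subset_insert _ _))
    _ ≤ _ := key _ _ (hK.insert a) (hL.insert b) (insert_nonempty _ _) (insert_nonempty _ _)
        (insert_subset ha hKA) (insert_subset hb hLB)

/-- The layer-cake formula for finite functions with values in `ℝ≥0∞`. -/
theorem lintegral_eq_lintegral_meas_ofReal_lt {α : Type*} [MeasurableSpace α] (μ : Measure α)
    {f : α → ℝ≥0∞} (hf : Measurable f) (hfin : ∀ x, f x ≠ ∞) :
    ∫⁻ x, f x ∂μ = ∫⁻ t in Ioi (0 : ℝ), μ {x | ENNReal.ofReal t < f x} := by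
  have h := lintegral_eq_lintegral_meas_lt μ (f := fun x => (f x).toReal)
    (Filter.Eventually.of_forall fun x => toReal_nonneg) hf.ennreal_toReal.aemeasurable
  simp_rw [ofReal_toReal (hfin _)] at h
  rw [h]
  refine setLIntegral_congr_fun measurableSet_Ioi fun t ht => ?_
  simp only [ofReal_lt_iff_lt_toReal (le_of_lt ht) (hfin _)]

theorem geom_mean_le_arith_mean_ennreal {a b : ℝ} (ha : 0 < a) (hb : 0 < b) (hab : a + b = 1)
    (u v : ℝ≥0∞) : u ^ a * v ^ b ≤ ENNReal.ofReal a * u + ENNReal.ofReal b * v := by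
  induction u with
  | top => simp [ENNReal.mul_top, ha]
  | coe u =>
    induction v with
    | top => simp [ENNReal.mul_top, hb]
    | coe v =>
      have := NNReal.geom_mean_le_arith_mean2_weighted ⟨a, ha.le⟩ ⟨b, hb.le⟩ u v
        (by ext; exact hab)
      rw [← coe_rpow_of_nonneg _ ha.le, ← coe_rpow_of_nonneg _ hb.le,
        ofReal_eq_coe_nnreal ha.le, ofReal_eq_coe_nnreal hb.le]
      exact_mod_cast this

/-- The one-dimensional Brunn-Minkowski inequality for convex combinations of sets. -/
theorem volume_combination_le {a b : ℝ} (ha : 0 < a) (hb : 0 < b) {A B C : Set ℝ}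
    (hA : MeasurableSet A) (hB : MeasurableSet B) (hA' : A.Nonempty) (hB' : B.Nonempty)
    (h : ∀ x ∈ A, ∀ y ∈ B, a * x + b * y ∈ C) :
    ENNReal.ofReal a * volume A + ENNReal.ofReal b * volume B ≤ volume C := by
  have hs : ∀ (c : ℝ) (D : Set ℝ), 0 < c → volume (c • D) = ENNReal.ofReal c * volume D := by
    intro c D hc
    simp [Measure.addHaar_smul, abs_of_pos hc]
  rw [← hs a A ha, ← hs b B hb]
  refine volume_add_volume_le (hA.const_smul_of_ne_zero ha.ne') (hB.const_smul_of_ne_zero hb.ne')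
    hA'.smul_set hB'.smul_set ?_
  rintro _ ⟨x, hx, rfl⟩ _ ⟨y, hy, rfl⟩
  exact h x hx y hy

/-- The Prékopa-Leindler inequality on the line for functions with supremum `1`: for `0 < t < 1` the
superlevel sets at height `t` of `f` and `g` are nonempty and combine into that of `h`, so the
Brunn-Minkowski inequality can be integrated over `t`. -/
theorem prekopaLeindler_real_of_iSup_eq_one {a b : ℝ} (ha : 0 < a) (hb : 0 < b) (hab : a + b = 1)
    {f g h : ℝ → ℝ≥0∞} (hf : Measurable f) (hg : Measurable g) (hh : Measurable h)
    (hf1 : ⨆ x, f x = 1) (hg1 : ⨆ x, g x = 1)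
    (hfgh : ∀ x y, f x ^ a * g y ^ b ≤ h (a * x + b * y)) :
    (∫⁻ x, f x) ^ a * (∫⁻ x, g x) ^ b ≤ ∫⁻ x, h x := by
  refine (geom_mean_le_arith_mean_ennreal ha hb hab _ _).trans ?_
  have hfle : ∀ x, f x ≤ 1 := fun x => hf1 ▸ le_iSup f x
  have hgle : ∀ x, g x ≤ 1 := fun x => hg1 ▸ le_iSup g x
  have hmeas : ∀ u : ℝ → ℝ≥0∞, Measurable fun t : ℝ => volume {x | ENNReal.ofReal t < u x} :=
    fun u => Antitone.measurable fun s t hst => measure_mono fun x (hx : _ < _) =>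
      (ofReal_le_ofReal hst).trans_lt hx
  have hcut : ∀ u : ℝ → ℝ≥0∞, Measurable u → (∀ x, u x ≤ 1) →
      ∫⁻ x, u x = ∫⁻ t in Ioo (0 : ℝ) 1, volume {x | ENNReal.ofReal t < u x} := by
    intro u hu hu1
    rw [lintegral_eq_lintegral_meas_ofReal_lt volume hu
      fun x => ((hu1 x).trans_lt one_lt_top).ne]
    rw [← Ioo_union_Ici_eq_Ioi (zero_lt_one' ℝ), lintegral_union measurableSet_Ici
      (Set.disjoint_left.2 fun x hx hx' => not_lt.2 hx' hx.2)]
    rw [setLIntegral_congr_fun (g := fun _ => 0) measurableSet_Ici, lintegral_zero, add_zero]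
    intro t ht
    have : {x | ENNReal.ofReal t < u x} = ∅ := by
      ext x
      simp only [mem_ofPred_eq, mem_empty_iff_false, iff_false, not_lt]
      exact (hu1 x).trans (by simpa using ht)
    simp [this]
  calc ENNReal.ofReal a * (∫⁻ x, f x) + ENNReal.ofReal b * ∫⁻ x, g x
      = ∫⁻ t in Ioo (0 : ℝ) 1, (ENNReal.ofReal a * volume {x | ENNReal.ofReal t < f x}
          + ENNReal.ofReal b * volume {x | ENNReal.ofReal t < g x}) := by
        rw [hcut f hf hfle, hcut g hg hgle, lintegral_add_left ((hmeas f).const_mul _),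
          lintegral_const_mul _ (hmeas f), lintegral_const_mul _ (hmeas g)]
    -- Cutting `h` off at `1` changes no superlevel set below height `1`, and makes `hcut` apply.
    _ ≤ ∫⁻ t in Ioo (0 : ℝ) 1, volume {x | ENNReal.ofReal t < min (h x) 1} := by
        refine setLIntegral_mono (hmeas _) fun t ht => ?_
        have ht1 : ENNReal.ofReal t < 1 := by simpa using ht.2
        have ht0 : ENNReal.ofReal t ≠ 0 := by simpa using ht.1
        refine volume_combination_le ha hb (measurableSet_lt measurable_const hf)
          (measurableSet_lt measurable_const hg) (lt_iSup_iff.1 (ht1.trans_eq hf1.symm))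
          (lt_iSup_iff.1 (ht1.trans_eq hg1.symm)) fun x hx y hy => lt_min ?_ ht1
        refine lt_of_lt_of_le ?_ (hfgh x y)
        calc ENNReal.ofReal t = ENNReal.ofReal t ^ a * ENNReal.ofReal t ^ b := by
              rw [← ENNReal.rpow_add _ _ ht0 ofReal_ne_top, hab, ENNReal.rpow_one]
          _ < _ := ENNReal.mul_lt_mul (ENNReal.rpow_lt_rpow hx ha) (ENNReal.rpow_lt_rpow hy hb)
    _ = ∫⁻ x, min (h x) 1 := (hcut _ (hh.min measurable_const) fun x => min_le_right _ _).symm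
    _ ≤ ∫⁻ x, h x := lintegral_mono fun x => min_le_left _ _

/-- The Prékopa-Leindler inequality on the line, for bounded functions. -/
theorem prekopaLeindler_real {a b : ℝ} (ha : 0 < a) (hb : 0 < b) (hab : a + b = 1)
    {f g h : ℝ → ℝ≥0∞} (hf : Measurable f) (hg : Measurable g) (hh : Measurable h)
    (hf1 : ⨆ x, f x ≠ ∞) (hg1 : ⨆ x, g x ≠ ∞)
    (hfgh : ∀ x y, f x ^ a * g y ^ b ≤ h (a * x + b * y)) :
    (∫⁻ x, f x) ^ a * (∫⁻ x, g x) ^ b ≤ ∫⁻ x, h x := by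
  set A := ⨆ x, f x with hA
  set B := ⨆ x, g x with hB
  rcases eq_or_ne A 0 with hA0 | hA0
  · have : ∀ x, f x = 0 := by simpa [hA] using hA0
    simp [this, ENNReal.zero_rpow_of_pos ha]
  rcases eq_or_ne B 0 with hB0 | hB0
  · have : ∀ x, g x = 0 := by simpa [hB] using hB0
    simp [this, ENNReal.zero_rpow_of_pos hb]
  have hC0 : A ^ a * B ^ b ≠ 0 := by
    simp [ENNReal.rpow_eq_zero_iff, hA0, hB0, hf1, hg1]
  have hC1 : A ^ a * B ^ b ≠ ∞ := ENNReal.mul_ne_top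
    (ENNReal.rpow_ne_top_of_nonneg ha.le hf1) (ENNReal.rpow_ne_top_of_nonneg hb.le hg1)
  have hsplit : ∀ u v : ℝ≥0∞, (u / A) ^ a * (v / B) ^ b = u ^ a * v ^ b / (A ^ a * B ^ b) := by
    intro u v
    rw [ENNReal.div_rpow_of_nonneg _ _ ha.le, ENNReal.div_rpow_of_nonneg _ _ hb.le, div_eq_mul_inv,
      div_eq_mul_inv, div_eq_mul_inv, ENNReal.mul_inv]
    · ring
    · right; exact ENNReal.rpow_ne_top_of_nonneg hb.le hg1
    · left; exact ENNReal.rpow_ne_top_of_nonneg ha.le hf1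
  have key := prekopaLeindler_real_of_iSup_eq_one ha hb hab (hf.div_const A) (hg.div_const B)
    (hh.div_const (A ^ a * B ^ b))
    (by rw [← ENNReal.iSup_div, ← hA, ENNReal.div_self hA0 hf1])
    (by rw [← ENNReal.iSup_div, ← hB, ENNReal.div_self hB0 hg1])
    (fun x y => by rw [hsplit]; exact ENNReal.div_le_div_right (hfgh x y) _)
  simp_rw [div_eq_mul_inv] at key
  rw [lintegral_mul_const _ hf, lintegral_mul_const _ hg, lintegral_mul_const _ hh] at key
  simp_rw [← div_eq_mul_inv] at key
  rw [hsplit] at key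
  rwa [ENNReal.div_le_iff hC0 hC1, ENNReal.div_mul_cancel hC0 hC1] at key

end Line

/-! ### Measures that satisfy the Prékopa-Leindler inequality -/

section LogConcave

open Set ENNReal

/-- A measure satisfies the Prékopa-Leindler inequality. The test functions `f` and `g` are bounded
by `1`, a bound that the marginals of a function under a probability measure inherit; this is what
the passage to product measures relies on. -/
def PrekopaLeindler {E : Type*} [AddCommGroup E] [Module ℝ E] [MeasurableSpace E]
    (μ : Measure E) : Prop :=
  ∀ (a b : ℝ), 0 < a → 0 < b → a + b = 1 → ∀ f g h : E → ℝ≥0∞,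
    Measurable f → Measurable g → Measurable h → (∀ x, f x ≤ 1) → (∀ x, g x ≤ 1) →
    (∀ x y, f x ^ a * g y ^ b ≤ h (a • x + b • y)) →
    (∫⁻ x, f x ∂μ) ^ a * (∫⁻ x, g x ∂μ) ^ b ≤ ∫⁻ x, h x ∂μ

theorem lintegral_le_one_of_le_one {α : Type*} [MeasurableSpace α] (μ : Measure α)
    [IsProbabilityMeasure μ] {f : α → ℝ≥0∞} (hf : ∀ x, f x ≤ 1) : ∫⁻ x, f x ∂μ ≤ 1 :=
  (lintegral_mono hf).trans_eq (by simp)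

/-- The centered Gaussian density is log-concave. -/
theorem gaussianPDF_rpow_mul_rpow_le {a b : ℝ} (ha : 0 < a) (hb : 0 < b) (hab : a + b = 1)
    {s : NNReal} (hs : s ≠ 0) (x y : ℝ) :
    gaussianPDF 0 s x ^ a * gaussianPDF 0 s y ^ b ≤ gaussianPDF 0 s (a * x + b * y) := by
  have hs' : (0 : ℝ) < s := by positivity
  simp only [gaussianPDF]
  rw [ofReal_rpow_of_pos (gaussianPDFReal_pos _ _ _ hs),
    ofReal_rpow_of_pos (gaussianPDFReal_pos _ _ _ hs), ← ofReal_mul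
      (Real.rpow_nonneg (gaussianPDFReal_nonneg _ _ _) _)]
  refine ofReal_le_ofReal ?_
  simp only [gaussianPDFReal, sub_zero]
  set c := (√(2 * Real.pi * s))⁻¹ with hc
  have hc0 : 0 < c := by positivity
  rw [Real.mul_rpow hc0.le (Real.exp_pos _).le, Real.mul_rpow hc0.le (Real.exp_pos _).le,
    ← Real.exp_mul, ← Real.exp_mul]
  calc c ^ a * Real.exp (-x ^ 2 / (2 * s) * a) * (c ^ b * Real.exp (-y ^ 2 / (2 * s) * b))
      = c ^ (a + b) * Real.exp (-x ^ 2 / (2 * s) * a + -y ^ 2 / (2 * s) * b) := by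
        rw [Real.rpow_add hc0, Real.exp_add]; ring
    _ = c * Real.exp (-(a * x ^ 2 + b * y ^ 2) / (2 * s)) := by
        rw [hab, Real.rpow_one]; congr 2; ring
    _ ≤ _ := by
        gcongr
        obtain rfl : b = 1 - a := by linarith
        nlinarith [mul_nonneg (mul_nonneg ha.le hb.le) (sq_nonneg (x - y))]

theorem PrekopaLeindler.gaussianReal {s : NNReal} (hs : s ≠ 0) :
    PrekopaLeindler (gaussianReal 0 s) := by
  intro a b ha hb hab f g h hf hg hh hf1 hg1 hfgh
  have hφ := measurable_gaussianPDF 0 s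
  rw [gaussianReal_of_var_ne_zero _ hs, lintegral_withDensity_eq_lintegral_mul _ hφ hf,
    lintegral_withDensity_eq_lintegral_mul _ hφ hg, lintegral_withDensity_eq_lintegral_mul _ hφ hh]
  have hbdd : ∀ u : ℝ → ℝ≥0∞, (∀ x, u x ≤ 1) → ⨆ x, (gaussianPDF 0 s * u) x ≠ ∞ := by
    intro u hu
    refine ((iSup_le fun x => ?_).trans_lt (ofReal_lt_top (r := (√(2 * Real.pi * s))⁻¹))).ne
    calc gaussianPDF 0 s x * u x ≤ gaussianPDF 0 s x * 1 := by gcongr; exact hu x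
      _ ≤ _ := by
        rw [mul_one]
        refine ofReal_le_ofReal (mul_le_of_le_one_right (by positivity) ?_)
        rw [Real.exp_le_one_iff]
        exact div_nonpos_of_nonpos_of_nonneg (by nlinarith [sq_nonneg (x - 0)]) (by positivity)
  refine prekopaLeindler_real ha hb hab (hφ.mul hf) (hφ.mul hg) (hφ.mul hh) (hbdd f hf1)
    (hbdd g hg1) fun x y => ?_
  simp only [Pi.mul_apply]
  rw [ENNReal.mul_rpow_of_nonneg _ _ ha.le, ENNReal.mul_rpow_of_nonneg _ _ hb.le]
  calc _ = (gaussianPDF 0 s x ^ a * gaussianPDF 0 s y ^ b) * (f x ^ a * g y ^ b) := by ring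
    _ ≤ _ := mul_le_mul' (gaussianPDF_rpow_mul_rpow_le ha hb hab hs x y) (hfgh x y)

variable {E F : Type*} [AddCommGroup E] [Module ℝ E] [MeasurableSpace E]
  [AddCommGroup F] [Module ℝ F] [MeasurableSpace F]

/-- The Prékopa-Leindler inequality on the second factor says that the marginals satisfy the
hypothesis of the Prékopa-Leindler inequality on the first factor. -/
theorem PrekopaLeindler.prod {μ : Measure E} {ν : Measure F} [IsProbabilityMeasure μ]
    [IsProbabilityMeasure ν] (hμ : PrekopaLeindler μ) (hν : PrekopaLeindler ν) :
    PrekopaLeindler (μ.prod ν) := by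
  intro a b ha hb hab f g h hf hg hh hf1 hg1 hfgh
  rw [lintegral_prod _ hf.aemeasurable, lintegral_prod _ hg.aemeasurable,
    lintegral_prod _ hh.aemeasurable]
  refine hμ a b ha hb hab _ _ _ hf.lintegral_prod_right' hg.lintegral_prod_right'
    hh.lintegral_prod_right' (fun x => lintegral_le_one_of_le_one ν fun y => hf1 _)
    (fun x => lintegral_le_one_of_le_one ν fun y => hg1 _) fun x y => ?_
  exact hν a b ha hb hab _ _ _ (hf.comp measurable_prodMk_left) (hg.comp measurable_prodMk_left)
    (hh.comp measurable_prodMk_left) (fun _ => hf1 _) (fun _ => hg1 _)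
    fun z w => hfgh (x, z) (y, w)

theorem PrekopaLeindler.map {μ : Measure E} (hμ : PrekopaLeindler μ) (L : E →ₗ[ℝ] F)
    (hL : Measurable L) : PrekopaLeindler (μ.map L) := by
  intro a b ha hb hab f g h hf hg hh hf1 hg1 hfgh
  rw [lintegral_map hf hL, lintegral_map hg hL, lintegral_map hh hL]
  refine hμ a b ha hb hab _ _ _ (hf.comp hL) (hg.comp hL) (hh.comp hL) (fun _ => hf1 _)
    (fun _ => hg1 _) fun x y => ?_
  simpa using hfgh (L x) (L y)

theorem PrekopaLeindler.of_subsingleton [Subsingleton E] (μ : Measure E)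
    [IsProbabilityMeasure μ] : PrekopaLeindler μ := by
  intro a b ha hb hab f g h hf hg hh hf1 hg1 hfgh
  have hc : ∀ u : E → ℝ≥0∞, ∫⁻ x, u x ∂μ = u 0 := by
    intro u
    rw [lintegral_congr (g := fun _ => u 0) fun x => by rw [Subsingleton.elim x 0],
      lintegral_const, measure_univ, mul_one]
  rw [hc, hc, hc]
  simpa using hfgh 0 0

theorem PrekopaLeindler.pi {μ : Measure E} [IsProbabilityMeasure μ] (hμ : PrekopaLeindler μ)
    (n : ℕ) : PrekopaLeindler (Measure.pi fun _ : Fin n => μ) := by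
  induction n with
  | zero => exact PrekopaLeindler.of_subsingleton _
  | succ n ih =>
    have hmp := (measurePreserving_piFinSuccAbove (fun _ : Fin (n + 1) => μ) 0).symm
    let L : E × (Fin n → E) →ₗ[ℝ] (Fin (n + 1) → E) :=
      { toFun := (MeasurableEquiv.piFinSuccAbove (fun _ : Fin (n + 1) => E) 0).symm
        map_add' := fun x y => by
          ext i; refine Fin.cases ?_ (fun i => ?_) i <;> simp [MeasurableEquiv.piFinSuccAbove]
        map_smul' := fun c x => by
          ext i; refine Fin.cases ?_ (fun i => ?_) i <;> simp [MeasurableEquiv.piFinSuccAbove] }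
    have := (hμ.prod ih).map L hmp.measurable
    rwa [show ((L : _ → _)) = (MeasurableEquiv.piFinSuccAbove (fun _ : Fin (n + 1) => E) 0).symm
      from rfl, hmp.map_eq] at this

end LogConcave

/-! ### Šidák's inequality -/

section Sidak

open Set ENNReal

/-- A form of Anderson's theorem: moving a symmetric convex set back towards the origin does not
decrease its measure, if the measure is symmetric and satisfies the Prékopa-Leindler inequality. -/
theorem PrekopaLeindler.measure_translate_le {E : Type*} [AddCommGroup E] [Module ℝ E]
    [MeasurableSpace E] [MeasurableAdd E] [MeasurableNeg E] {μ : Measure E}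
    (hμ : PrekopaLeindler μ) (hneg : μ.map (fun x => -x) = μ) {K : Set E} (hK : MeasurableSet K)
    (hconv : Convex ℝ K) (hsymm : ∀ x ∈ K, -x ∈ K) (e : E) {s : ℝ} (hs : |s| ≤ 1) :
    μ {w | e + w ∈ K} ≤ μ {w | s • e + w ∈ K} := by
  have hmeas : ∀ v : E, MeasurableSet {w | v + w ∈ K} := fun v => measurable_const_add v hK
  have hflip : μ {w | -e + w ∈ K} = μ {w | e + w ∈ K} := by
    conv_lhs => rw [← hneg]
    rw [Measure.map_apply measurable_neg (hmeas _)]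
    congr 1
    ext w
    constructor
    · intro hw
      have := hsymm _ hw
      simpa [add_comm] using this
    · intro hw
      have := hsymm _ hw
      simpa [add_comm] using this
  rcases eq_or_lt_of_le (abs_le.1 hs).1 with h1 | h1
  · rw [← h1, neg_one_smul, hflip]
  rcases eq_or_lt_of_le (abs_le.1 hs).2 with h2 | h2
  · rw [h2, one_smul]
  -- `s • e` is the convex combination of `e` and `-e` with the weights `(1 + s) / 2`, `(1 - s) / 2`.
  have ha : 0 < (1 + s) / 2 := by linarith
  have hb : 0 < (1 - s) / 2 := by linarith
  have hab : (1 + s) / 2 + (1 - s) / 2 = 1 := by ring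
  have key := hμ _ _ ha hb hab ({w | e + w ∈ K}.indicator 1) ({w | -e + w ∈ K}.indicator 1)
    ({w | s • e + w ∈ K}.indicator 1) (measurable_one.indicator (hmeas _))
    (measurable_one.indicator (hmeas _)) (measurable_one.indicator (hmeas _))
    (fun x => indicator_le_self' (by simp) x) (fun x => indicator_le_self' (by simp) x) ?_
  · rw [lintegral_indicator_one (hmeas _), lintegral_indicator_one (hmeas _),
      lintegral_indicator_one (hmeas _), hflip, ← ENNReal.rpow_add_of_nonneg _ _ ha.le hb.le, hab,
      ENNReal.rpow_one] at key
    exact key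
  · intro x y
    by_cases hx : e + x ∈ K
    swap
    · simp [indicator, hx, ENNReal.zero_rpow_of_pos ha]
    by_cases hy : -e + y ∈ K
    swap
    · simp [indicator, hy, ENNReal.zero_rpow_of_pos hb]
    have hxy : s • e + (((1 + s) / 2) • x + ((1 - s) / 2) • y) ∈ K := by
      convert hconv hx hy ha.le hb.le hab using 1
      module
    simp [indicator, hx, hy, hxy]

/-- The indicator of a symmetric interval is positively correlated with any function of `u` that
decreases in `|u|`. -/
theorem measure_abs_lt_mul_lintegral_le (ρ : Measure ℝ) [IsProbabilityMeasure ρ] {g : ℝ → ℝ≥0∞}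
    (hg : ∀ u v, |u| ≤ |v| → g v ≤ g u) (t : ℝ) :
    ρ {u | |u| < t} * ∫⁻ u, g u ∂ρ ≤ ∫⁻ u in {u | |u| < t}, g u ∂ρ := by
  rcases le_or_gt t 0 with ht | ht
  · have : {u : ℝ | |u| < t} = ∅ := by
      ext u
      simpa using ht.trans (abs_nonneg u)
    simp [this]
  set S : Set ℝ := {u | |u| < t} with hS
  have hSm : MeasurableSet S := measurableSet_lt (by fun_prop) measurable_const
  have hin : ρ S * g t ≤ ∫⁻ u in S, g u ∂ρ := by
    rw [mul_comm, ← setLIntegral_const]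
    refine setLIntegral_mono' hSm fun u hu => hg _ _ ?_
    rw [abs_of_pos ht]
    exact le_of_lt hu
  have hout : ∫⁻ u in Sᶜ, g u ∂ρ ≤ ρ Sᶜ * g t := by
    rw [mul_comm, ← setLIntegral_const]
    refine setLIntegral_mono' hSm.compl fun u hu => hg _ _ ?_
    rw [abs_of_pos ht]
    exact not_lt.1 hu
  calc ρ S * ∫⁻ u, g u ∂ρ = ρ S * ∫⁻ u in S, g u ∂ρ + ρ S * ∫⁻ u in Sᶜ, g u ∂ρ := by
        rw [← lintegral_add_compl g hSm, mul_add]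
    _ ≤ ρ S * ∫⁻ u in S, g u ∂ρ + ρ Sᶜ * ∫⁻ u in S, g u ∂ρ := by
        refine add_le_add le_rfl ?_
        calc ρ S * ∫⁻ u in Sᶜ, g u ∂ρ ≤ ρ S * (ρ Sᶜ * g t) := by gcongr
          _ = ρ Sᶜ * (ρ S * g t) := by ring
          _ ≤ _ := by gcongr
    _ = ∫⁻ u in S, g u ∂ρ := by rw [← add_mul, prob_add_prob_compl hSm, one_mul]

variable {E : Type*} [NormedAddCommGroup E] [NormedSpace ℝ E] [MeasurableSpace E] [BorelSpace E]
  [CompleteSpace E] [SecondCountableTopology E]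

/-- Under a centered Gaussian measure, a continuous linear functional `l` is independent of the
remainder `x - l x • e` for a suitable vector `e`. -/
theorem exists_indepFun_sub_smul {ν : Measure E} [IsGaussian ν]
    (hneg : ν.map (fun x => -x) = ν) (l : StrongDual ℝ E) (hl : Var[l; ν] ≠ 0) :
    ∃ e : E, IndepFun l (ContinuousLinearMap.id ℝ E - l.smulRight e) ν := by
  have hmean : ∀ l' : StrongDual ℝ E, ν[l'] = 0 := by
    intro l'
    have h : ν[l'] = -ν[l'] := by
      conv_lhs => rw [← hneg]
      rw [integral_map (by fun_prop) (by fun_prop)]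
      simp [integral_neg]
    linarith
  have hL2 : ∀ l' : StrongDual ℝ E, MemLp l' 2 ν := fun l' =>
    IsGaussian.memLp_dual ν l' 2 (by simp)
  have hint : Integrable (fun x => l x • x) ν := by
    have h := (IsGaussian.memLp_two_id (μ := ν)).smul (hL2 l) (r := 1)
    exact memLp_one_iff_integrable.1 h
  -- This `e` makes the remainder uncorrelated with `l`: `l' e = cov[l, l'] / Var[l]` for all `l'`.
  refine ⟨(Var[l; ν])⁻¹ • ∫ x, l x • x ∂ν, ?_⟩
  set e := (Var[l; ν])⁻¹ • ∫ x, l x • x ∂ν with he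
  have hcov : ∀ l' : StrongDual ℝ E, cov[l, l'; ν] = l' e * Var[l; ν] := by
    intro l'
    rw [covariance_eq_sub (hL2 _) (hL2 _), hmean, zero_mul, sub_zero, he, map_smul,
      ← l'.integral_comp_comm hint]
    simp only [map_smul, smul_eq_mul, Pi.mul_apply]
    field_simp
  have hG : HasGaussianLaw
      (fun x => (l x, (ContinuousLinearMap.id ℝ E - l.smulRight e) x)) ν :=
    (IsGaussian.hasGaussianLaw_id (μ := ν)).map
      (l.prod (ContinuousLinearMap.id ℝ E - l.smulRight e))
  refine hG.indepFun_of_covariance_strongDual fun L₁ L₂ => ?_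
  have h1 : L₁ ∘ l = L₁ 1 • (l : E → ℝ) := by
    ext x
    have : L₁ (l x • 1) = l x * L₁ 1 := by rw [map_smul, smul_eq_mul]
    simpa [mul_comm] using this
  have h2 : L₂ ∘ (ContinuousLinearMap.id ℝ E - l.smulRight e)
      = (L₂ : E → ℝ) - L₂ e • (l : E → ℝ) := by
    ext x
    simp [mul_comm]
  have h3 : cov[l, L₂ e • (l : E → ℝ); ν] = L₂ e * Var[l; ν] := by
    rw [covariance_smul_right, covariance_self (by fun_prop)]
  rw [h1, h2, covariance_smul_left, covariance_sub_right (hL2 _) (hL2 _) ((hL2 _).const_smul _),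
    h3, hcov, sub_self, mul_zero]

/-- A symmetric slab and a symmetric convex set are positively correlated under a centered Gaussian
measure. Given `l x = u`, the probability of `K` is that of a section of `K` translated by `u • e`,
and this decreases in `|u|`. -/
theorem measure_slab_mul_le {ν : Measure E} [IsGaussian ν] (hν : PrekopaLeindler ν)
    (hneg : ν.map (fun x => -x) = ν) {K : Set E} (hK : MeasurableSet K)
    (hconv : Convex ℝ K) (hsymm : ∀ x ∈ K, -x ∈ K) (l : StrongDual ℝ E) (hl : Var[l; ν] ≠ 0)
    (t : ℝ) : ν {x | |l x| < t} * ν K ≤ ν ({x | |l x| < t} ∩ K) := by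
  obtain ⟨e, he⟩ := exists_indepFun_sub_smul hneg l hl
  set W : E →L[ℝ] E := ContinuousLinearMap.id ℝ E - l.smulRight e with hW
  have hWm : Measurable W := W.continuous.measurable
  have hlm : Measurable l := l.continuous.measurable
  have hsplit : ∀ x, l x • e + W x = x := fun x => by simp [hW]
  set ρ := ν.map l with hρ
  set ω := ν.map W with hω
  have : IsProbabilityMeasure ρ := Measure.isProbabilityMeasure_map hlm.aemeasurable
  have : IsProbabilityMeasure ω := Measure.isProbabilityMeasure_map hWm.aemeasurable
  have hjoint : ν.map (fun x => (l x, W x)) = ρ.prod ω :=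
    he.map_prod_eq_prod_map_map hlm.aemeasurable hWm.aemeasurable
  have hωPL : PrekopaLeindler ω := hν.map W.toLinearMap hWm
  have hωneg : ω.map (fun x => -x) = ω := by
    rw [hω, Measure.map_map measurable_neg hWm]
    conv_rhs => rw [← hneg]
    rw [Measure.map_map hWm measurable_neg]
    congr 1
    ext x
    simp
  set g : ℝ → ℝ≥0∞ := fun u => ω {w | u • e + w ∈ K} with hg
  have hanti : ∀ u v, |u| ≤ |v| → g v ≤ g u := by
    intro u v huv
    rcases eq_or_ne v 0 with rfl | hv
    · have : u = 0 := by simpa using huv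
      rw [this]
    have h := hωPL.measure_translate_le hωneg hK hconv hsymm (v • e) (s := u / v)
      (by rw [abs_div]; exact div_le_one_of_le₀ huv (abs_nonneg _))
    rwa [smul_smul, div_mul_cancel₀ _ hv] at h
  have hKm : MeasurableSet {p : ℝ × E | p.1 • e + p.2 ∈ K} :=
    (by fun_prop : Measurable fun p : ℝ × E => p.1 • e + p.2) hK
  have hSm : MeasurableSet {u : ℝ | |u| < t} := measurableSet_lt (by fun_prop) measurable_const
  have hνK : ν K = ∫⁻ u, g u ∂ρ := by
    refine Eq.trans ?_ (Measure.prod_apply hKm)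
    rw [← hjoint, Measure.map_apply (by fun_prop) hKm]
    congr 1
    ext x
    simp [hsplit]
  have hνSK : ν ({x | |l x| < t} ∩ K) = ∫⁻ u in {u | |u| < t}, g u ∂ρ := by
    have hm : MeasurableSet {p : ℝ × E | |p.1| < t ∧ p.1 • e + p.2 ∈ K} :=
      (measurable_fst hSm).inter hKm
    have h : ν ({x | |l x| < t} ∩ K)
        = (ρ.prod ω) {p : ℝ × E | |p.1| < t ∧ p.1 • e + p.2 ∈ K} := by
      rw [← hjoint, Measure.map_apply (by fun_prop) hm]
      congr 1
      ext x
      simp [hsplit]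
    rw [h, Measure.prod_apply hm, ← lintegral_indicator hSm]
    refine lintegral_congr fun u => ?_
    by_cases hu : |u| < t <;> simp [indicator, hu, hg]
  have hνS : ν {x | |l x| < t} = ρ {u | |u| < t} := by
    rw [hρ, Measure.map_apply hlm hSm]
    rfl
  rw [hνS, hνK, hνSK]
  exact measure_abs_lt_mul_lintegral_le ρ hanti t

/-- Šidák's inequality: symmetric slabs are positively correlated under a centered Gaussian
measure. -/
theorem prod_measure_slab_le {ν : Measure E} [IsGaussian ν] (hν : PrekopaLeindler ν)
    (hneg : ν.map (fun x => -x) = ν) {ι : Type*} (s : Finset ι) (l : ι → StrongDual ℝ E)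
    (hl : ∀ i ∈ s, Var[l i; ν] ≠ 0) (t : ℝ) :
    ∏ i ∈ s, ν {x | |l i x| < t} ≤ ν {x | ∀ i ∈ s, |l i x| < t} := by
  classical
  induction s using Finset.induction_on with
  | empty => simp
  | insert j s hj ih =>
    rw [Finset.prod_insert hj]
    have hset : {x | ∀ i ∈ insert j s, |l i x| < t}
        = {x | |l j x| < t} ∩ {x | ∀ i ∈ s, |l i x| < t} := by
      ext x
      simp
    have hinter : {x | ∀ i ∈ s, |l i x| < t} = ⋂ i ∈ s, l i ⁻¹' Metric.ball 0 t := by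
      ext x
      simp
    rw [hset]
    refine (mul_le_mul_right (ih fun i hi => hl i (Finset.mem_insert_of_mem hi)) _).trans
      (measure_slab_mul_le hν hneg ?_ ?_ ?_ (l j) (hl j (Finset.mem_insert_self _ _)) t)
    · rw [hinter]
      exact s.measurableSet_biInter fun i _ =>
        (l i).continuous.measurable Metric.isOpen_ball.measurableSet
    · rw [hinter]
      exact convex_iInter₂ fun i _ => (convex_ball (0 : ℝ) t).linear_preimage (l i).toLinearMap
    · intro x hx i hi
      simpa using hx i hi

end Sidak

/-! ### Gaussian tails -/

section Tail

open Set Filter Topology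

theorem hasDerivAt_inv_sqrt_mul_exp {x : ℝ} (hx : 0 < x) :
    HasDerivAt (fun u : ℝ => (√u)⁻¹ * Real.exp (-(u ^ 2 / 2)))
      (-((√x + (2 * √x ^ 3)⁻¹) * Real.exp (-(x ^ 2 / 2)))) x := by
  have hs : 0 < √x := Real.sqrt_pos.2 hx
  have h1 := (Real.hasDerivAt_sqrt hx.ne').inv hs.ne'
  have h2 : HasDerivAt (fun u : ℝ => Real.exp (-(u ^ 2 / 2)))
      (Real.exp (-(x ^ 2 / 2)) * (-x)) x := by
    have h3 : HasDerivAt (fun u : ℝ => -(u ^ 2 / 2)) (-x) x := by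
      convert! (((hasDerivAt_id x).pow 2).div_const 2).neg using 1
      simp
    exact h3.exp
  convert! h1.mul h2 using 1
  have hin : (√x)⁻¹ * x = √x := by
    rw [inv_mul_eq_div, Real.div_sqrt]
  have : (√x)⁻¹ * (Real.exp (-(x ^ 2 / 2)) * -x) = -(√x * Real.exp (-(x ^ 2 / 2))) := by
    rw [mul_neg, mul_neg, neg_inj, mul_left_comm, hin, mul_comm]
  simp only [Pi.inv_apply]
  rw [this]
  field_simp
  ring

theorem one_le_add_inv {s : ℝ} (hs : 0 < s) : 1 ≤ s + (2 * s ^ 3)⁻¹ := by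
  have h3 : 0 < 2 * s ^ 3 := by positivity
  rw [← sub_nonneg]
  have : s + (2 * s ^ 3)⁻¹ - 1 = (2 * s ^ 4 + 1 - 2 * s ^ 3) / (2 * s ^ 3) := by
    field_simp
  rw [this]
  refine div_nonneg ?_ h3.le
  nlinarith [sq_nonneg (s ^ 2 - s), sq_nonneg (s ^ 2 - 1 / 2), sq_nonneg (s - 1),
    sq_nonneg (s ^ 2 - s / 2 - 1 / 2), sq_nonneg (s ^ 2 - s / 2 - 1 / 4)]

/-- A Gaussian tail bound with the factor `1 / √t` in place of the `1 / t` of Mills' ratio, which makes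
it useful for `t < 1` too. Minus the derivative of the right-hand side is
`(√t + 1 / (2 √t ^ 3)) * exp (-t ^ 2 / 2)`, and dominates the integrand. -/
theorem integral_Ioi_exp_le {t : ℝ} (ht : 0 < t) :
    ∫ x in Ioi t, Real.exp (-(x ^ 2 / 2)) ≤ (√t)⁻¹ * Real.exp (-(t ^ 2 / 2)) := by
  set F : ℝ → ℝ := fun u => (√u)⁻¹ * Real.exp (-(u ^ 2 / 2)) with hF
  set F' : ℝ → ℝ := fun x => -((√x + (2 * √x ^ 3)⁻¹) * Real.exp (-(x ^ 2 / 2))) with hF'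
  have hderiv : ∀ x ∈ Ici t, HasDerivAt F (F' x) x := fun x hx =>
    hasDerivAt_inv_sqrt_mul_exp (ht.trans_le hx)
  have hneg : ∀ x ∈ Ioi t, F' x ≤ 0 := fun x _ => by
    simp only [hF', neg_nonpos]
    positivity
  have hlim : Tendsto F atTop (𝓝 0) := by
    have h1 : Tendsto (fun u : ℝ => (√u)⁻¹) atTop (𝓝 0) :=
      tendsto_inv_atTop_zero.comp Real.tendsto_sqrt_atTop
    refine squeeze_zero (fun u => by positivity) (fun u => ?_) h1
    refine mul_le_of_le_one_right (by positivity) ?_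
    rw [Real.exp_le_one_iff]
    nlinarith [sq_nonneg u]
  have hint := integrableOn_Ioi_deriv_of_nonpos' hderiv hneg hlim
  have hval := integral_Ioi_of_hasDerivAt_of_nonpos' hderiv hneg hlim
  have hexp : IntegrableOn (fun x : ℝ => Real.exp (-(x ^ 2 / 2))) (Ioi t) := by
    have := (integrable_exp_neg_mul_sq (b := 1 / 2) (by norm_num)).integrableOn (s := Ioi t)
    refine this.congr_fun (fun x _ => ?_) measurableSet_Ioi
    ring_nf
  calc ∫ x in Ioi t, Real.exp (-(x ^ 2 / 2)) ≤ ∫ x in Ioi t, -F' x := by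
        refine setIntegral_mono_on hexp hint.neg measurableSet_Ioi fun x hx => ?_
        simp only [hF', neg_neg]
        exact le_mul_of_one_le_left (Real.exp_pos _).le
          (one_le_add_inv (Real.sqrt_pos.2 (ht.trans hx)))
    _ = F t := by rw [integral_neg, hval]; ring

theorem gaussianReal_Ioi_le {t : ℝ} (ht : 0 < t) :
    (gaussianReal 0 1).real (Ioi t)
      ≤ (√(2 * Real.pi))⁻¹ * ((√t)⁻¹ * Real.exp (-(t ^ 2 / 2))) := by
  rw [measureReal_def, gaussianReal_apply_eq_integral 0 one_ne_zero,
    ENNReal.toReal_ofReal (integral_nonneg fun x => gaussianPDFReal_nonneg _ _ _)]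
  have : ∫ x in Ioi t, gaussianPDFReal 0 1 x
      = (√(2 * Real.pi))⁻¹ * ∫ x in Ioi t, Real.exp (-(x ^ 2 / 2)) := by
    rw [← integral_const_mul]
    refine integral_congr_ae (Eventually.of_forall fun x => ?_)
    simp [gaussianPDFReal, neg_div]
  rw [this]
  gcongr
  exact integral_Ioi_exp_le ht

theorem le_gaussianReal_abs_lt {s : NNReal} (hs : s ≠ 0) {t τ : ℝ} (ht : 0 < t)
    (hτ : τ = t * √s) :
    1 - √(2 / Real.pi) * (√t)⁻¹ * Real.exp (-(t ^ 2 / 2))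
      ≤ (gaussianReal 0 s).real {u | |u| < τ} := by
  have hs' : (0 : ℝ) < s := by positivity
  have hsq : 0 < √(s : ℝ) := Real.sqrt_pos.2 hs'
  have hscale : (gaussianReal 0 1).map (√(s : ℝ) * ·) = gaussianReal 0 s := by
    rw [gaussianReal_map_const_mul, mul_zero, mul_one]
    congr 1
    ext
    simp
  have hm : MeasurableSet {u : ℝ | |u| < τ} := measurableSet_lt (by fun_prop) measurable_const
  have hm1 : MeasurableSet {u : ℝ | |u| < t} := measurableSet_lt (by fun_prop) measurable_const
  have hstd : (gaussianReal 0 s).real {u | |u| < τ} = (gaussianReal 0 1).real {u | |u| < t} := by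
    rw [← hscale, map_measureReal_apply (by fun_prop) hm]
    congr 1
    ext u
    rw [mem_preimage, mem_ofPred_eq, mem_ofPred_eq, abs_mul, abs_of_pos hsq, hτ, mul_comm,
      mul_lt_mul_iff_left₀ hsq]
  have hnull : NullSingletonClass (gaussianReal 0 1) := nullSingletonClass_gaussianReal one_ne_zero
  have hIci : (gaussianReal 0 1).real (Ici t) = (gaussianReal 0 1).real (Ioi t) :=
    measureReal_congr Ioi_ae_eq_Ici.symm
  have hIic : (gaussianReal 0 1).real (Iic (-t)) = (gaussianReal 0 1).real (Ici t) := by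
    have h : (gaussianReal 0 1).map (fun x => -x) = gaussianReal 0 1 := by
      rw [gaussianReal_map_neg, neg_zero]
    conv_lhs => rw [← h]
    rw [map_measureReal_apply measurable_neg measurableSet_Iic]
    congr 1
    ext u
    simp
  have hcompl : {u : ℝ | |u| < t}ᶜ = Iic (-t) ∪ Ici t := by
    ext u
    simp only [mem_compl_iff, mem_ofPred_eq, not_lt, le_abs, mem_union, mem_Iic, mem_Ici]
    constructor
    · rintro (h | h)
      · exact Or.inr h
      · exact Or.inl (by linarith)
    · rintro (h | h)
      · exact Or.inr (by linarith)
      · exact Or.inl h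
  have hc : √(2 / Real.pi) = 2 * (√(2 * Real.pi))⁻¹ := by
    have : 2 / Real.pi = (2 * (√(2 * Real.pi))⁻¹) ^ 2 := by
      rw [mul_pow, inv_pow, Real.sq_sqrt (by positivity)]
      field_simp
    rw [this, Real.sqrt_sq (by positivity)]
  have h1 := probReal_add_probReal_compl (μ := gaussianReal 0 1) hm1
  have h2 := measureReal_union_le (μ := gaussianReal 0 1) (Iic (-t)) (Ici t)
  have h3 := gaussianReal_Ioi_le ht
  rw [hcompl] at h1
  rw [hstd, hc]
  rw [hIic, hIci] at h2
  linarith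

end Tail

/-! ### Complex white noise -/

section Noise

open Set

theorem complexGaussian_eq_map (s : NNReal) :
    complexGaussian s = ((gaussianReal 0 (s / 2)).prod (gaussianReal 0 (s / 2))).map
      Complex.equivRealProdCLM.symm := by
  rw [complexGaussian]
  congr 1

instance isGaussian_complexGaussian (s : NNReal) : IsGaussian (complexGaussian s) := by
  rw [complexGaussian_eq_map]
  infer_instance

theorem PrekopaLeindler.complexGaussian {s : NNReal} (hs : s ≠ 0) :
    PrekopaLeindler (complexGaussian s) := by
  have h := PrekopaLeindler.gaussianReal (div_ne_zero hs two_ne_zero)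
  rw [complexGaussian_eq_map]
  exact (h.prod h).map Complex.equivRealProdCLM.symm.toLinearEquiv.toLinearMap
    Complex.equivRealProdCLM.symm.continuous.measurable

theorem complexGaussian_map_neg (s : NNReal) :
    (complexGaussian s).map (fun z => -z) = complexGaussian s := by
  have h : (gaussianReal 0 (s / 2)).map (fun x => -x) = gaussianReal 0 (s / 2) := by
    rw [gaussianReal_map_neg, neg_zero]
  have h2 : ((gaussianReal 0 (s / 2)).prod (gaussianReal 0 (s / 2))).map
      (Prod.map (fun x => -x) (fun x => -x))
      = (gaussianReal 0 (s / 2)).prod (gaussianReal 0 (s / 2)) := by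
    rw [← Measure.map_prod_map _ _ measurable_neg measurable_neg, h]
  rw [complexGaussian_eq_map]
  conv_rhs => rw [← h2]
  have hm := Complex.equivRealProdCLM.symm.continuous.measurable
  rw [Measure.map_map measurable_neg hm, Measure.map_map hm (by fun_prop)]
  congr 1

theorem variance_re_mul_complexGaussian (s : NNReal) (c : ℂ) :
    Var[fun z => (c * z).re; complexGaussian s] = s / 2 * ‖c‖ ^ 2 := by
  rw [complexGaussian_eq_map, variance_map (by fun_prop)
    Complex.equivRealProdCLM.symm.continuous.measurable.aemeasurable]
  have hfun : (fun z : ℂ => (c * z).re) ∘ Complex.equivRealProdCLM.symm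
      = fun p : ℝ × ℝ => c.re * p.1 + -c.im * p.2 := by
    ext p
    simp [sub_eq_add_neg]
  have hL2 : MemLp (fun x : ℝ => x) 2 (gaussianReal 0 (s / 2)) := IsGaussian.memLp_two_id
  rw [hfun, variance_add_prod (X := fun x => c.re * x) (Y := fun x => -c.im * x)
    (hL2.const_mul _) (hL2.const_mul _), variance_const_mul, variance_const_mul,
    variance_fun_id_gaussianReal, ← Complex.normSq_eq_norm_sq, Complex.normSq_apply]
  push_cast
  ring

/-- The real-linear functional `v ↦ Re (b* v)` on `ℂ^M`. -/
noncomputable def reInner {M : ℕ} (b : Fin M → ℂ) : StrongDual ℝ (Fin M → ℂ) :=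
  ∑ m, (Complex.reCLM.comp (ContinuousLinearMap.mul ℝ ℂ (star (b m)))).comp
    (ContinuousLinearMap.proj m)

theorem reInner_apply {M : ℕ} (b v : Fin M → ℂ) : reInner b v = (star b ⬝ᵥ v).re := by
  simp [reInner, dotProduct]

theorem reInner_I_smul {M : ℕ} (b v : Fin M → ℂ) :
    reInner (Complex.I • b) v = (star b ⬝ᵥ v).im := by
  simp [reInner_apply, star_smul, smul_dotProduct]

/-- The law of `M` independent circularly symmetric complex Gaussians of variance `s`. -/
noncomputable def noiseLaw (M : ℕ) (s : NNReal) : Measure (Fin M → ℂ) :=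
  Measure.pi fun _ => complexGaussian s

instance isGaussian_noiseLaw (M : ℕ) (s : NNReal) : IsGaussian (noiseLaw M s) := by
  have h := iIndepFun.hasGaussianLaw (P := noiseLaw M s) (X := fun m v => v m)
    (fun m => (measurePreserving_eval (fun _ : Fin M => complexGaussian s) m).hasLaw.hasGaussianLaw)
    (iIndepFun_pi (X := fun _ z => z) fun _ => aemeasurable_id)
  have h2 := h.isGaussian_map
  rwa [show (fun (v : Fin M → ℂ) m => v m) = id from rfl, Measure.map_id] at h2

theorem noiseLaw_map_neg (M : ℕ) (s : NNReal) :
    (noiseLaw M s).map (fun v => -v) = noiseLaw M s := by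
  have h := Measure.pi_map_pi (μ := fun _ : Fin M => complexGaussian s)
    (f := fun _ z => -z) (fun _ => measurable_neg.aemeasurable)
  simp only [complexGaussian_map_neg] at h
  exact h

theorem variance_reInner {M : ℕ} (s : NNReal) (b : Fin M → ℂ) :
    Var[reInner b; noiseLaw M s] = s / 2 * ∑ m, ‖b m‖ ^ 2 := by
  have hfun : (reInner b : (Fin M → ℂ) → ℝ)
      = ∑ m, fun v : Fin M → ℂ => (star (b m) * v m).re := by
    ext v
    simp [reInner]
  have hL2 : ∀ m, MemLp (fun z : ℂ => (star (b m) * z).re) 2 (complexGaussian s) := fun m =>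
    IsGaussian.memLp_dual (complexGaussian s)
      (Complex.reCLM.comp (ContinuousLinearMap.mul ℝ ℂ (star (b m)))) 2 (by simp)
  rw [hfun, noiseLaw, variance_sum_pi (X := fun m z => (star (b m) * z).re) hL2, Finset.mul_sum]
  exact Finset.sum_congr rfl fun m _ => by rw [variance_re_mul_complexGaussian, norm_star]

theorem noiseLaw_map_reInner {M : ℕ} (s : NNReal) {b : Fin M → ℂ} (hb : ∑ m, ‖b m‖ ^ 2 = 1) :
    (noiseLaw M s).map (reInner b) = gaussianReal 0 (s / 2) := by
  have hmean : (noiseLaw M s)[reInner b] = 0 := by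
    have h : (noiseLaw M s)[reInner b] = -(noiseLaw M s)[reInner b] := by
      conv_lhs => rw [← noiseLaw_map_neg]
      rw [integral_map (by fun_prop) (by fun_prop)]
      simp [integral_neg]
    linarith
  rw [IsGaussian.map_eq_gaussianReal, hmean, variance_reInner, hb, mul_one]
  congr 1
  ext
  rw [Real.coe_toNNReal _ (by positivity)]
  simp

/-- With probability at least the stated power, complex white noise of variance `σ ^ 2` has inner
products of modulus less than `γ` with all the unit vectors `b j`. The vectors need not be
orthogonal: Šidák's inequality is applied to the real and imaginary parts of the inner products,
which give two slabs for each `j`. -/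
theorem le_noiseLaw_norm_lt {M : ℕ} {ι : Type*} [Fintype ι] (b : ι → Fin M → ℂ)
    (hb : ∀ j, ∑ m, ‖b j m‖ ^ 2 = 1) {σ γ : ℝ} (hσ : 0 < σ) (hγ : 0 < γ) :
    (max 0 (1 - √(2 / Real.pi) * √(σ / γ) * Real.exp (-(γ ^ 2 / (2 * σ ^ 2)))))
      ^ (2 * Fintype.card ι)
      ≤ (noiseLaw M (Real.toNNReal (σ ^ 2))).real {v | ∀ j, ‖star (b j) ⬝ᵥ v‖ < γ} := by
  set s : NNReal := Real.toNNReal (σ ^ 2) with hs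
  have hsσ : (s : ℝ) = σ ^ 2 := Real.coe_toNNReal _ (by positivity)
  have hs0 : s ≠ 0 := by
    intro h
    rw [h] at hsσ
    exact (pow_pos hσ 2).ne hsσ
  set ν := noiseLaw M s with hν
  -- `reInner` of `b j` and of `I • b j` are the real and the imaginary part of the inner product.
  let β : ι × Bool → Fin M → ℂ := fun i => if i.2 then Complex.I • b i.1 else b i.1
  have hβ : ∀ i, ∑ m, ‖β i m‖ ^ 2 = 1 := by
    rintro ⟨j, _ | _⟩ <;> simp [β, hb]
  have hvar : ∀ i ∈ (Finset.univ : Finset (ι × Bool)), Var[reInner (β i); ν] ≠ 0 := by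
    intro i _
    rw [variance_reInner, hβ, hsσ]
    positivity
  have hPL : PrekopaLeindler ν := (PrekopaLeindler.complexGaussian hs0).pi M
  have hprod := prod_measure_slab_le hPL (noiseLaw_map_neg M s) Finset.univ
    (fun i => reInner (β i)) hvar (γ / √2)
  have hsub : {v | ∀ i ∈ (Finset.univ : Finset (ι × Bool)), |reInner (β i) v| < γ / √2}
      ⊆ {v | ∀ j, ‖star (b j) ⬝ᵥ v‖ < γ} := by
    intro v hv j
    have h1 : |(star (b j) ⬝ᵥ v).re| < γ / √2 := by
      simpa [β, reInner_apply] using hv (j, false) (Finset.mem_univ _)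
    have h2 : |(star (b j) ⬝ᵥ v).im| < γ / √2 := by
      have := hv (j, true) (Finset.mem_univ _)
      simpa only [β, if_true, reInner_I_smul] using this
    rw [← sq_lt_sq₀ (norm_nonneg _) hγ.le, ← Complex.normSq_eq_norm_sq, Complex.normSq_apply]
    have h3 : (γ / √2) ^ 2 = γ ^ 2 / 2 := by rw [div_pow, Real.sq_sqrt (by norm_num)]
    have h4 := sq_lt_sq' (abs_lt.1 h1).1 (abs_lt.1 h1).2
    have h5 := sq_lt_sq' (abs_lt.1 h2).1 (abs_lt.1 h2).2
    nlinarith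
  have hone : ∀ i, max 0 (1 - √(2 / Real.pi) * √(σ / γ) * Real.exp (-(γ ^ 2 / (2 * σ ^ 2))))
      ≤ ν.real {v | |reInner (β i) v| < γ / √2} := by
    intro i
    refine max_le measureReal_nonneg ?_
    have hm : MeasurableSet {u : ℝ | |u| < γ / √2} :=
      measurableSet_lt (by fun_prop) measurable_const
    have h := le_gaussianReal_abs_lt (s := s / 2) (div_ne_zero hs0 two_ne_zero)
      (t := γ / σ) (τ := γ / √2) (by positivity) (by
        push_cast
        rw [hsσ, Real.sqrt_div (by positivity), Real.sqrt_sq hσ.le]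
        field_simp)
    rw [← noiseLaw_map_reInner s (hβ i), map_measureReal_apply
      (reInner (β i)).continuous.measurable hm] at h
    refine le_trans (le_of_eq ?_) h
    congr 2
    · rw [← Real.sqrt_inv, inv_div]
    · congr 2
      field_simp
  have hcard : Fintype.card (ι × Bool) = 2 * Fintype.card ι := by
    rw [Fintype.card_prod, Fintype.card_bool, mul_comm]
  calc _ = ∏ i : ι × Bool,
        max 0 (1 - √(2 / Real.pi) * √(σ / γ) * Real.exp (-(γ ^ 2 / (2 * σ ^ 2)))) := by
        rw [Finset.prod_const, Finset.card_univ, hcard]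
    _ ≤ ∏ i : ι × Bool, ν.real {v | |reInner (β i) v| < γ / √2} :=
        Finset.prod_le_prod (fun _ _ => le_max_left _ _) fun i _ => hone i
    _ = (∏ i : ι × Bool, ν {v | |reInner (β i) v| < γ / √2}).toReal := by
        rw [ENNReal.toReal_prod]
        rfl
    _ ≤ (ν {v | ∀ j, ‖star (b j) ⬝ᵥ v‖ < γ}).toReal :=
        ENNReal.toReal_mono (measure_ne_top _ _) (hprod.trans (measure_mono hsub))

end Noise

/-! ### Orthogonal matching pursuit under a coherence condition -/


theorem l2norm_sq {α : Type*} [Fintype α] (u : α → ℂ) : l2norm u ^ 2 = ∑ i, ‖u i‖ ^ 2 :=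
  EuclideanSpace.norm_sq_eq _

theorem l2norm_nonneg {α : Type*} [Fintype α] (u : α → ℂ) : 0 ≤ l2norm u := norm_nonneg _

theorem star_dotProduct_self {α : Type*} [Fintype α] (u : α → ℂ) :
    star u ⬝ᵥ u = ((l2norm u ^ 2 : ℝ) : ℂ) := by
  rw [l2norm_sq, dotProduct]
  push_cast
  refine Finset.sum_congr rfl fun i _ => ?_
  rw [← Complex.conj_mul']
  rfl

theorem coherence_nonneg {κ ι : Type*} [Fintype κ] (A : Matrix κ ι ℂ) : 0 ≤ coherence A :=
  Real.iSup_nonneg fun _ => div_nonneg (norm_nonneg _)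
    (mul_nonneg (l2norm_nonneg _) (l2norm_nonneg _))

section Greedy

variable {κ ι : Type*} [Fintype κ] [Fintype ι]

theorem dMin_le_colNorm (A : Matrix κ ι ℂ) (j : ι) : dMin A ≤ colNorm A j :=
  ciInf_le (Set.finite_range _).bddBelow j

theorem colNorm_le_dMax (A : Matrix κ ι ℂ) (j : ι) : colNorm A j ≤ dMax A :=
  le_ciSup (Set.finite_range _).bddAbove j

theorem norm_star_col_dotProduct_col_le {A : Matrix κ ι ℂ} (hA : ∀ j, 0 < colNorm A j) {i j : ι}
    (hij : i ≠ j) :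
    ‖star (A.col i) ⬝ᵥ A.col j‖ ≤ coherence A * (colNorm A i * colNorm A j) := by
  rw [← div_le_iff₀ (mul_pos (hA i) (hA j))]
  exact le_ciSup (f := fun p : {p : ι × ι // p.1 ≠ p.2} =>
    ‖star (A.col p.1.1) ⬝ᵥ A.col p.1.2‖ / (colNorm A p.1.1 * colNorm A p.1.2))
    (Set.finite_range _).bddAbove ⟨(i, j), hij⟩

/-- The interference of the other columns with the `j`-th one, in the inner product of `A *ᵥ u` with
the `j`-th column, is controlled by the coherence. -/
theorem norm_star_col_dotProduct_mulVec_sub_le [DecidableEq ι] {A : Matrix κ ι ℂ}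
    (hA : ∀ j, 0 < colNorm A j) {u : ι → ℂ} {T : Finset ι} (hu : ∀ i, i ∉ T → u i = 0) (j : ι) :
    ‖star (A.col j) ⬝ᵥ (A *ᵥ u) - u j * ((colNorm A j ^ 2 : ℝ) : ℂ)‖
      ≤ colNorm A j * (coherence A * ∑ i ∈ T.erase j, ‖u i‖ * colNorm A i) := by
  have h1 : star (A.col j) ⬝ᵥ (A *ᵥ u) = ∑ i, u i * (star (A.col j) ⬝ᵥ A.col i) := by
    simp only [Matrix.mulVec, dotProduct, Finset.mul_sum, Matrix.col_apply]
    rw [Finset.sum_comm]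
    exact Finset.sum_congr rfl fun i _ => Finset.sum_congr rfl fun m _ => by ring
  have h2 : star (A.col j) ⬝ᵥ (A *ᵥ u) - u j * ((colNorm A j ^ 2 : ℝ) : ℂ)
      = ∑ i ∈ T.erase j, u i * (star (A.col j) ⬝ᵥ A.col i) := by
    rw [h1, ← Finset.add_sum_erase _ _ (Finset.mem_univ j), star_dotProduct_self, colNorm,
      add_sub_cancel_left]
    refine (Finset.sum_subset (Finset.erase_subset_erase j (Finset.subset_univ T)) ?_).symm
    intro i hi hi'
    have hij := Finset.ne_of_mem_erase hi
    rw [hu i fun hiT => hi' (Finset.mem_erase.2 ⟨hij, hiT⟩), zero_mul]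
  rw [h2, Finset.mul_sum, Finset.mul_sum]
  refine norm_sum_le_of_le _ fun i hi => ?_
  rw [norm_mul]
  calc ‖u i‖ * ‖star (A.col j) ⬝ᵥ A.col i‖
      ≤ ‖u i‖ * (coherence A * (colNorm A j * colNorm A i)) := by
        gcongr
        exact norm_star_col_dotProduct_col_le hA (Finset.ne_of_mem_erase hi).symm
    _ = _ := by ring

/-- The residual of a least-squares fit is orthogonal to the columns that were fitted. -/
theorem IsLeastSquaresOn.star_col_dotProduct_eq_zero {A : Matrix κ ι ℂ} {y : κ → ℂ} {Λ : Finset ι}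
    {z : ι → ℂ} (h : IsLeastSquaresOn A y Λ z) {j : ι} (hj : j ∈ Λ) (hA : 0 < colNorm A j) :
    star (A.col j) ⬝ᵥ (y - A *ᵥ z) = 0 := by
  classical
  set a : EuclideanSpace ℂ κ := WithLp.toLp 2 (A.col j) with ha
  set r : EuclideanSpace ℂ κ := WithLp.toLp 2 (y - A *ᵥ z) with hr
  have hinner : inner ℂ a r = star (A.col j) ⬝ᵥ (y - A *ᵥ z) := by
    rw [EuclideanSpace.inner_eq_star_dotProduct, dotProduct_comm]
  have hmin : ∀ c : ℂ, ‖r‖ ≤ ‖r - c • a‖ := by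
    intro c
    have := h.2 (z + Pi.single j c) fun i hi => by
      have hij : i ≠ j := fun e => hi (e ▸ hj)
      simp [h.1 i hi, hij]
    convert! this using 1
    simp only [l2norm]
    congr 1
    ext m
    simp [hr, ha, Matrix.mulVec_add, sub_sub]
  rw [← hinner]
  by_contra hne
  have ha0 : 0 < ‖a‖ := hA
  -- Subtracting the projection of `r` on `a` would make the residual shorter.
  have h1 := hmin (inner ℂ a r / (‖a‖ : ℂ) ^ 2)
  have h2 : ‖r - (inner ℂ a r / (‖a‖ : ℂ) ^ 2) • a‖ ^ 2
      = ‖r‖ ^ 2 - ‖inner ℂ a r‖ ^ 2 / ‖a‖ ^ 2 := by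
    rw [@norm_sub_sq ℂ, inner_smul_right, norm_smul, ← inner_conj_symm r a, div_mul_eq_mul_div,
      Complex.mul_conj']
    have : RCLike.re ((‖inner ℂ a r‖ : ℂ) ^ 2 / (‖a‖ : ℂ) ^ 2) = ‖inner ℂ a r‖ ^ 2 / ‖a‖ ^ 2 := by
      rw [← Complex.ofReal_pow, ← Complex.ofReal_pow, ← Complex.ofReal_div]
      exact Complex.ofReal_re _
    rw [this, norm_div, norm_pow, Complex.norm_real, norm_norm]
    field_simp
    ring
  have h3 : 0 < ‖inner ℂ a r‖ ^ 2 / ‖a‖ ^ 2 := by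
    have := norm_pos_iff.2 hne
    positivity
  have h4 : ‖r‖ ^ 2 ≤ ‖r - (inner ℂ a r / (‖a‖ : ℂ) ^ 2) • a‖ ^ 2 := by gcongr
  linarith

/-- A column that is most correlated with `A *ᵥ u + w` belongs to the support of `u`, if the largest
term `‖u i‖ * colNorm A i` dominates the noise. The noise bound is strict, which is what excludes
ties with a column outside the support. The positivity of the largest correlation rules out the
columns that are orthogonal to the residual. -/
theorem mem_of_forall_correlation_le [DecidableEq ι] {A : Matrix κ ι ℂ}
    (hA : ∀ j, 0 < colNorm A j) {w : κ → ℂ} {γ : ℝ}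
    (hw : ∀ j, ‖star (A.col j) ⬝ᵥ w‖ < γ * colNorm A j) {u : ι → ℂ} {T : Finset ι}
    (hu : ∀ i, i ∉ T → u i = 0)
    (hμ : ∃ i ∈ T, 2 * γ ≤ (1 - (2 * (T.card : ℝ) - 1) * coherence A) * (‖u i‖ * colNorm A i))
    (hμ' : 0 ≤ 1 - (2 * (T.card : ℝ) - 1) * coherence A)
    {j : ι} (hj : ∀ i, correlation A (A *ᵥ u + w) i ≤ correlation A (A *ᵥ u + w) j) :
    j ∈ T ∧ 0 < correlation A (A *ᵥ u + w) j := by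
  obtain ⟨i₁, hi₁, hbig₁⟩ := hμ
  obtain ⟨i₀, hi₀, hmax⟩ := T.exists_max_image (fun i => ‖u i‖ * colNorm A i) ⟨i₁, hi₁⟩
  set τ := ‖u i₀‖ * colNorm A i₀ with hτ
  have hμ0 := coherence_nonneg A
  have hτ0 : 0 ≤ τ := mul_nonneg (norm_nonneg _) (hA _).le
  have hbig : 2 * γ ≤ (1 - (2 * (T.card : ℝ) - 1) * coherence A) * τ :=
    hbig₁.trans (mul_le_mul_of_nonneg_left (hmax i₁ hi₁) hμ')
  have hγ : 0 < γ := by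
    have := (norm_nonneg _).trans_lt (hw j)
    exact (pos_iff_pos_of_mul_pos this).2 (hA j)
  have hk : (1 : ℝ) ≤ T.card := by exact_mod_cast Finset.card_pos.2 ⟨i₁, hi₁⟩
  -- The largest term is reduced by the interference of the `T.card - 1` others and by the noise.
  have hlow : (1 - ((T.card : ℝ) - 1) * coherence A) * τ - γ
      < correlation A (A *ᵥ u + w) i₀ := by
    rw [correlation, lt_div_iff₀ (hA i₀), dotProduct_add]
    have h1 := norm_star_col_dotProduct_mulVec_sub_le hA hu i₀
    have h2 : ∑ i ∈ T.erase i₀, ‖u i‖ * colNorm A i ≤ ((T.card : ℝ) - 1) * τ := by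
      refine (Finset.sum_le_card_nsmul _ _ τ fun i hi => hmax i (Finset.mem_of_mem_erase hi)).trans
        (le_of_eq ?_)
      rw [Finset.card_erase_of_mem hi₀, nsmul_eq_mul, Nat.cast_sub (by exact_mod_cast hk),
        Nat.cast_one]
    have h3 : ‖u i₀ * ((colNorm A i₀ ^ 2 : ℝ) : ℂ)‖ = τ * colNorm A i₀ := by
      rw [norm_mul, Complex.norm_real, Real.norm_of_nonneg (by positivity)]
      ring
    have h4 : ‖u i₀ * ((colNorm A i₀ ^ 2 : ℝ) : ℂ)‖
        ≤ ‖star (A.col i₀) ⬝ᵥ (A *ᵥ u) + star (A.col i₀) ⬝ᵥ w‖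
          + ‖star (A.col i₀) ⬝ᵥ (A *ᵥ u) - u i₀ * ((colNorm A i₀ ^ 2 : ℝ) : ℂ)‖
          + ‖star (A.col i₀) ⬝ᵥ w‖ := by
      rw [← norm_neg (star (A.col i₀) ⬝ᵥ (A *ᵥ u) - u i₀ * ((colNorm A i₀ ^ 2 : ℝ) : ℂ)),
        ← norm_neg (star (A.col i₀) ⬝ᵥ w)]
      refine le_trans (le_of_eq ?_) (norm_add₃_le)
      congr 1
      ring
    have h5 : coherence A * ∑ i ∈ T.erase i₀, ‖u i‖ * colNorm A i
        ≤ coherence A * (((T.card : ℝ) - 1) * τ) := by gcongr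
    have h6 := mul_le_mul_of_nonneg_left h5 (hA i₀).le
    have h7 := hw i₀
    rw [h3] at h4
    nlinarith
  -- Off the support there is only interference, of `T.card` terms, and noise.
  have hup : ∀ i, i ∉ T → correlation A (A *ᵥ u + w) i < T.card * coherence A * τ + γ := by
    intro i hi
    rw [correlation, div_lt_iff₀ (hA i), dotProduct_add]
    have h1 := norm_star_col_dotProduct_mulVec_sub_le hA hu i
    rw [hu i hi, zero_mul, sub_zero, Finset.erase_eq_of_notMem hi] at h1
    have h2 : ∑ i ∈ T, ‖u i‖ * colNorm A i ≤ (T.card : ℝ) * τ :=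
      (Finset.sum_le_card_nsmul _ _ τ hmax).trans (le_of_eq (nsmul_eq_mul _ _))
    have h5 : coherence A * ∑ i ∈ T, ‖u i‖ * colNorm A i
        ≤ coherence A * ((T.card : ℝ) * τ) := by gcongr
    have h6 := mul_le_mul_of_nonneg_left h5 (hA i).le
    have h7 := hw i
    have h8 := norm_add_le (star (A.col i) ⬝ᵥ (A *ᵥ u)) (star (A.col i) ⬝ᵥ w)
    nlinarith
  have hpos : (T.card : ℝ) * coherence A * τ + γ < correlation A (A *ᵥ u + w) j :=
    lt_of_le_of_lt (by nlinarith) (hlow.trans_le (hj i₀))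
  refine ⟨?_, lt_trans (by positivity) hpos⟩
  by_contra hjT
  exact absurd (hup j hjT) (not_lt.2 hpos.le)

/-- The invariant of orthogonal matching pursuit: all selected indices are distinct and lie in the
support, and the residual is orthogonal to the selected columns. -/
theorem OMPState.subset_supp [DecidableEq ι] {A : Matrix κ ι ℂ} (hA : ∀ j, 0 < colNorm A j)
    {x : ι → ℂ} {w y : κ → ℂ} (hy : y = A *ᵥ x + w) {γ : ℝ}
    (hw : ∀ j, ‖star (A.col j) ⬝ᵥ w‖ < γ * colNorm A j) {T : Finset ι}
    (hx : ∀ i, i ∉ T → x i = 0)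
    (hμ : ∀ i ∈ T, 2 * γ ≤ (1 - (2 * (T.card : ℝ) - 1) * coherence A) * (‖x i‖ * colNorm A i))
    (hμ' : 0 ≤ 1 - (2 * (T.card : ℝ) - 1) * coherence A)
    {t : ℕ} {Λ : Finset ι} {z : ι → ℂ} (h : OMPState A y t Λ z) (ht : t ≤ T.card) :
    Λ ⊆ T ∧ Λ.card = t ∧ (∀ j, j ∉ Λ → z j = 0) ∧
      ∀ j ∈ Λ, star (A.col j) ⬝ᵥ (y - A *ᵥ z) = 0 := by
  induction h with
  | init => simp
  | @step t Λ z z' j prev select update ih =>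
    obtain ⟨hΛT, hcard, hz, horth⟩ := ih (Nat.le_of_succ_le ht)
    have hres : y - A *ᵥ z = A *ᵥ (x - z) + w := by
      rw [hy, Matrix.mulVec_sub]
      abel
    -- At an index of the support not yet selected, the error `x - z` still is `x i`.
    obtain ⟨i, hiT, hiΛ⟩ : ∃ i ∈ T, i ∉ Λ := by
      by_contra! hcon
      have := Finset.card_le_card hcon
      omega
    rw [hres] at select
    obtain ⟨hjT, hpos⟩ := mem_of_forall_correlation_le hA hw (u := x - z) (T := T)
      (fun i hi => by simp [hx i hi, hz i fun h => hi (hΛT h)])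
      ⟨i, hiT, by simpa [hz i hiΛ] using hμ i hiT⟩ hμ' select
    have hjΛ : j ∉ Λ := by
      intro hj
      rw [← hres, correlation, horth j hj, norm_zero, zero_div] at hpos
      exact lt_irrefl _ hpos
    refine ⟨Finset.insert_subset hjT hΛT, by rw [Finset.card_insert_of_notMem hjΛ, hcard],
      update.1, fun i hi => update.star_col_dotProduct_eq_zero hi (hA i)⟩

/-- A sparse solution `e` of the normal equations for the noise is small, since the Gram matrix of the
normalized columns is diagonally dominant. It is enough to look at the largest entry. -/
theorem norm_mul_colNorm_le_of_orthogonal {A : Matrix κ ι ℂ}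
    (hA : ∀ j, 0 < colNorm A j) {w : κ → ℂ} {γ : ℝ}
    (hw : ∀ j, ‖star (A.col j) ⬝ᵥ w‖ ≤ γ * colNorm A j) {e : ι → ℂ} {T : Finset ι}
    (he : ∀ i, i ∉ T → e i = 0) (hμ : 0 < 1 - ((T.card : ℝ) - 1) * coherence A)
    (horth : ∀ j ∈ T, star (A.col j) ⬝ᵥ (A *ᵥ e) = star (A.col j) ⬝ᵥ w) {j : ι} (hj : j ∈ T) :
    ‖e j‖ * colNorm A j ≤ γ / (1 - ((T.card : ℝ) - 1) * coherence A) := by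
  classical
  obtain ⟨i₀, hi₀, hmax⟩ := T.exists_max_image (fun i => ‖e i‖ * colNorm A i) ⟨j, hj⟩
  refine (hmax j hj).trans ?_
  set τ := ‖e i₀‖ * colNorm A i₀ with hτ
  have hμ0 := coherence_nonneg A
  have hk : 1 ≤ T.card := Finset.card_pos.2 ⟨j, hj⟩
  rw [le_div_iff₀ hμ]
  have h1 := norm_star_col_dotProduct_mulVec_sub_le hA he i₀
  have h2 : ∑ i ∈ T.erase i₀, ‖e i‖ * colNorm A i ≤ ((T.card : ℝ) - 1) * τ := by
    refine (Finset.sum_le_card_nsmul _ _ τ fun i hi => hmax i (Finset.mem_of_mem_erase hi)).trans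
      (le_of_eq ?_)
    rw [Finset.card_erase_of_mem hi₀, nsmul_eq_mul, Nat.cast_sub hk, Nat.cast_one]
  have h3 : ‖e i₀ * ((colNorm A i₀ ^ 2 : ℝ) : ℂ)‖ = τ * colNorm A i₀ := by
    rw [norm_mul, Complex.norm_real, Real.norm_of_nonneg (by positivity)]
    ring
  have h4 := norm_sub_norm_le (e i₀ * ((colNorm A i₀ ^ 2 : ℝ) : ℂ))
    (star (A.col i₀) ⬝ᵥ (A *ᵥ e))
  rw [norm_sub_rev, h3, horth i₀ hi₀] at h4
  rw [horth i₀ hi₀] at h1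
  have h5 : coherence A * ∑ i ∈ T.erase i₀, ‖e i‖ * colNorm A i
      ≤ coherence A * (((T.card : ℝ) - 1) * τ) := by gcongr
  have h6 := mul_le_mul_of_nonneg_left h5 (hA i₀).le
  have h7 := hw i₀
  refine le_of_mul_le_mul_right ?_ (hA i₀)
  nlinarith

/-- The recovery condition forces `x` to be nonzero (the infimum `xMin x` is `0` for an empty support)
and all columns of `A` to be nonzero. -/
theorem dMin_pos_and_xMin_pos {A : Matrix κ ι ℂ} {x : ι → ℂ} {γ : ℝ} (hγ : 0 < γ)
    (hcond : dMin A * xMin x - (2 * ((supp x).card : ℝ) - 1) * coherence A * dMax A * xMin x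
      ≥ 2 * γ) : 0 < dMin A ∧ 0 < xMin x ∧ 0 < (supp x).card := by
  have hk : 0 < (supp x).card := by
    rw [Finset.card_pos, Finset.nonempty_iff_ne_empty]
    intro h
    have : IsEmpty (supp x) := by rw [h]; infer_instance
    have h0 : xMin x = 0 := by rw [xMin, Real.iInf_of_isEmpty]
    rw [h0] at hcond
    linarith
  have hk1 : (1 : ℝ) ≤ (supp x).card := by exact_mod_cast hk
  have hx0 : 0 ≤ xMin x := Real.iInf_nonneg fun _ => norm_nonneg _
  have hx1 : xMin x ≠ 0 := by
    intro h
    rw [h] at hcond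
    linarith
  have hx : 0 < xMin x := lt_of_le_of_ne hx0 hx1.symm
  have hM : 0 ≤ dMax A := Real.iSup_nonneg fun _ => l2norm_nonneg _
  have hp : 0 ≤ (2 * ((supp x).card : ℝ) - 1) * coherence A * dMax A * xMin x :=
    mul_nonneg (mul_nonneg (mul_nonneg (by linarith) (coherence_nonneg A)) hM) hx0
  have hd : 0 < dMin A * xMin x := by linarith
  exact ⟨(pos_iff_pos_of_mul_pos hd).2 hx, hx, hk⟩

/-- The deterministic guarantee for orthogonal matching pursuit: it recovers the support and a good
estimate whenever the noise correlates little with each of the normalized columns. -/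
theorem OMPState.eq_supp_and_l2norm_le [DecidableEq ι] {A : Matrix κ ι ℂ} {x : ι → ℂ}
    {w y : κ → ℂ} (hy : y = A *ᵥ x + w) {γ : ℝ} (hγ : 0 < γ) {k : ℕ} (hk : (supp x).card = k)
    (hcond : dMin A * xMin x - (2 * (k : ℝ) - 1) * coherence A * dMax A * xMin x ≥ 2 * γ)
    (hw : ∀ j, ‖star (A.col j) ⬝ᵥ w‖ < γ * colNorm A j) {Λ : Finset ι} {xhat : ι → ℂ}
    (h : OMPState A y k Λ xhat) :
    Λ = supp x ∧ l2norm (xhat - x) ^ 2 ≤ (dMax A / dMin A) ^ 2 *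
      (k * γ ^ 2 / (dMin A - ((k : ℝ) - 1) * coherence A * dMax A) ^ 2) := by
  subst hk
  obtain ⟨hd, hxm, hk⟩ := dMin_pos_and_xMin_pos hγ hcond
  have hA : ∀ j, 0 < colNorm A j := fun j => hd.trans_le (dMin_le_colNorm A j)
  have hx : ∀ i, i ∉ supp x → x i = 0 := fun i hi => by simpa [supp] using hi
  have hk1 : (1 : ℝ) ≤ (supp x).card := by exact_mod_cast hk
  have hμ0 := coherence_nonneg A
  have hdD : dMin A ≤ dMax A := by
    obtain ⟨i, -⟩ := Finset.card_pos.1 hk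
    exact (dMin_le_colNorm A i).trans (colNorm_le_dMax A i)
  set d := dMin A
  set D := dMax A
  set μ := coherence A
  set n : ℝ := ((supp x).card : ℝ)
  have hnμ : 0 ≤ (2 * n - 1) * μ := mul_nonneg (by linarith) hμ0
  have hsmall : 2 * γ ≤ (1 - (2 * n - 1) * μ) * (xMin x * d) := by
    have := mul_le_mul_of_nonneg_left hdD (mul_nonneg hnμ hxm.le)
    linarith
  have hone : 0 < 1 - (2 * n - 1) * μ :=
    (pos_iff_pos_of_mul_pos (lt_of_lt_of_le (by positivity) hsmall)).2 (mul_pos hxm hd)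
  have hbig : ∀ i ∈ supp x, 2 * γ ≤ (1 - (2 * n - 1) * μ) * (‖x i‖ * colNorm A i) := by
    intro i hi
    refine hsmall.trans (mul_le_mul_of_nonneg_left ?_ hone.le)
    exact mul_le_mul (ciInf_le (f := fun j : supp x => ‖x j‖)
      (Set.finite_range _).bddBelow ⟨i, hi⟩) (dMin_le_colNorm A i) hd.le (norm_nonneg _)
  obtain ⟨hsub, hcard, hz, horth⟩ := h.subset_supp hA hy hw hx hbig hone.le le_rfl
  have hΛ : Λ = supp x := Finset.eq_of_subset_of_card_le hsub hcard.ge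
  refine ⟨hΛ, ?_⟩
  rw [hΛ] at hz horth
  set e := xhat - x with he
  have he0 : ∀ i, i ∉ supp x → e i = 0 := fun i hi => by simp [he, hz i hi, hx i hi]
  have hres : y - A *ᵥ xhat = w - A *ᵥ e := by
    rw [hy, he, Matrix.mulVec_sub]
    abel
  have hone' : 0 < 1 - (n - 1) * μ := by nlinarith
  have hgap : 0 < d - (n - 1) * μ * D := by
    have h1 : 0 < (d - (2 * n - 1) * μ * D) * xMin x := by linarith
    have h2 := (pos_iff_pos_of_mul_pos h1).2 hxm
    have h3 : 0 ≤ n * μ * D := by have := hd.trans_le hdD; positivity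
    linarith
  have hcoord : ∀ j, j ∈ supp x → ‖e j‖ ^ 2 ≤ (γ / (1 - (n - 1) * μ) / d) ^ 2 := by
    intro j hj
    have h1 := norm_mul_colNorm_le_of_orthogonal hA (fun j => (hw j).le) he0 hone'
      (fun j hj => by
        have := horth j hj
        rw [hres, dotProduct_sub, sub_eq_zero] at this
        exact this.symm) hj
    have h2 : ‖e j‖ ≤ γ / (1 - (n - 1) * μ) / d := by
      rw [le_div_iff₀ hd]
      exact (mul_le_mul_of_nonneg_left (dMin_le_colNorm A j) (norm_nonneg _)).trans h1
    gcongr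
  have hsum : l2norm e ^ 2 ≤ n * (γ / (1 - (n - 1) * μ) / d) ^ 2 := by
    rw [l2norm_sq, ← Finset.sum_subset (Finset.subset_univ (supp x))
      fun i _ hi => by simp [he0 i hi]]
    exact (Finset.sum_le_card_nsmul _ _ _ hcoord).trans (le_of_eq (nsmul_eq_mul _ _))
  refine hsum.trans ?_
  have hle : γ / (1 - (n - 1) * μ) / d ≤ D / d * (γ / (d - (n - 1) * μ * D)) := by
    have h1 : γ / (1 - (n - 1) * μ) ≤ D * (γ / (d - (n - 1) * μ * D)) := by
      rw [← mul_div_assoc, div_le_div_iff₀ hone' hgap]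
      nlinarith
    calc γ / (1 - (n - 1) * μ) / d ≤ D * (γ / (d - (n - 1) * μ * D)) / d := by gcongr
      _ = _ := by ring
  calc n * (γ / (1 - (n - 1) * μ) / d) ^ 2
      ≤ n * (D / d * (γ / (d - (n - 1) * μ * D))) ^ 2 := by gcongr
    _ = _ := by
        generalize d - (n - 1) * μ * D = g
        ring

end Greedy

/-! ### The in-sector measurements -/

section Model

variable {N M : ℕ}

theorem dft_neg_right [NeZero N] (j k : Fin N) : dft N j (-k) = star (dft N j k) := by
  have hN : (N : ℂ) ≠ 0 := Nat.cast_ne_zero.2 (NeZero.ne N)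
  simp only [dft, Matrix.of_apply, star_mul', Complex.star_def, Complex.conj_ofReal,
    ← Complex.exp_conj]
  congr 1
  simp only [map_neg, map_div₀, map_mul, Complex.conj_ofReal, Complex.conj_I, map_natCast,
    map_ofNat]
  rw [Fin.val_neg]
  split_ifs with hk
  · simp [hk]
  · rw [Nat.cast_sub k.isLt.le, Complex.exp_eq_exp_iff_exists_int]
    refine ⟨-(j : ℕ), ?_⟩
    push_cast
    field_simp
    ring

theorem dft_comm (j k : Fin N) : dft N j k = dft N k j := by
  simp only [dft, Matrix.of_apply]
  congr 3
  ring

/-- Flipping and conjugating a matrix conjugates its inverse discrete Fourier transform. -/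
theorem conjTranspose_dft_mul_flipConj_mul [NeZero N] (P : Matrix (Fin N) (Fin N) ℂ)
    (p q : Fin N) :
    ((dft N)ᴴ * flipConj P * (dft N)ᴴ) p q = star (((dft N)ᴴ * P * (dft N)ᴴ) p q) := by
  simp only [Matrix.mul_apply, Matrix.conjTranspose_apply, flipConj, Matrix.of_apply, star_sum,
    star_mul', star_star]
  -- Substitute `j ↦ -j` and `i ↦ -i` in the double sum.
  rw [← Equiv.sum_comp (Equiv.neg (Fin N))]
  refine Finset.sum_congr rfl fun j _ => ?_
  rw [← Equiv.sum_comp (Equiv.neg (Fin N))]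
  simp only [Equiv.neg_apply, neg_neg, dft_neg_right, star_star]
  congr 1
  refine Finset.sum_congr rfl fun i _ => ?_
  rw [dft_comm (-i) p, dft_neg_right, star_star, dft_comm p i]

theorem spectralMask_eq_zero [NeZero N] {P : Matrix (Fin N) (Fin N) ℂ} {p q : Fin N}
    (h : (p, q) ∉ sector P) : spectralMask P p q = 0 := by
  have h0 : ((dft N)ᴴ * P * (dft N)ᴴ) p q = 0 := by simpa [sector] using h
  rw [spectralMask, Matrix.smul_apply, conjTranspose_dft_mul_flipConj_mul, h0, star_zero,
    smul_zero]

/-- The spectral mask vanishes outside the sector, so that only the columns of the sector contribute to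
the measurements. -/
theorem csMatrix_mulVec_vec [NeZero N] (P X : Matrix (Fin N) (Fin N) ℂ) (r c : Fin M → Fin N) :
    csMatrix P r c *ᵥ X.vec = inSectorMatrix P r c *ᵥ inSectorVector P X := by
  ext m
  simp only [Matrix.mulVec, dotProduct, inSectorMatrix, inSectorVector, Matrix.submatrix_apply,
    id_eq]
  rw [Finset.sum_coe_sort (sectorIndices P) fun l => csMatrix P r c m l * X.vec l]
  refine (Finset.sum_subset (Finset.subset_univ _) fun l _ hl => ?_).symm
  have hl' : (l.2, l.1) ∉ sector P := by simpa [sectorIndices] using hl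
  rw [csMatrix, Matrix.mul_diagonal, Matrix.vec, spectralMask_eq_zero hl', mul_zero, zero_mul]

theorem card_sectorIndices (P : Matrix (Fin N) (Fin N) ℂ) :
    (sectorIndices P).card = (sector P).card :=
  Finset.card_equiv (Equiv.prodComm _ _) fun l => by simp [sectorIndices, Prod.swap]

end Model


end InSector

theorem theorem1 {Ω : Type*} [MeasurableSpace Ω] (Pr : Measure Ω) [IsProbabilityMeasure Pr]
    {N M S : ℕ} [NeZero N]
    (P : Matrix (Fin N) (Fin N) ℂ) (hS : S * (InSector.sector P).card = N ^ 2)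
    (r c : Fin M → Fin N)
    (X : Matrix (Fin N) (Fin N) ℂ)
    (σ γ : ℝ) (hσ : 0 < σ) (hγ : 0 < γ)
    (v : Fin M → Ω → ℂ)
    (hv : ∀ m, HasLaw (v m) (InSector.complexGaussian (Real.toNNReal (σ ^ 2))) Pr)
    (hindep : iIndepFun v Pr)
    (y : Ω → Fin M → ℂ)
    (hy : ∀ ω, y ω = InSector.csMatrix P r c *ᵥ X.vec + fun m => v m ω)
    (A : Matrix (Fin M) (InSector.sectorIndices P) ℂ)
    (hA : A = InSector.inSectorMatrix P r c)
    (x : InSector.sectorIndices P → ℂ) (hx : x = InSector.inSectorVector P X)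
    (k : ℕ) (hk : (InSector.supp x).card = k)
    (hcond : InSector.dMin A * InSector.xMin x
        - (2 * (k : ℝ) - 1) * InSector.coherence A * InSector.dMax A * InSector.xMin x
        ≥ 2 * γ) :
    ∃ E : Set Ω, MeasurableSet E ∧
      (max 0 (1 - √(2 / Real.pi) * √(σ / γ) * Real.exp (-(γ ^ 2 / (2 * σ ^ 2)))))
          ^ (2 * N ^ 2 / S) ≤ Pr.real E ∧
      ∀ ω ∈ E, ∀ (Λ : Finset (InSector.sectorIndices P)) (xhat : InSector.sectorIndices P → ℂ),
        InSector.OMPState A (y ω) k Λ xhat →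
          Λ = InSector.supp x ∧
          InSector.l2norm (xhat - x) ^ 2 ≤
            (InSector.dMax A / InSector.dMin A) ^ 2 *
              (k * γ ^ 2 /
                (InSector.dMin A - ((k : ℝ) - 1) * InSector.coherence A * InSector.dMax A) ^ 2) := by
  have hd : 0 < InSector.dMin A :=
    (InSector.dMin_pos_and_xMin_pos (x := x) hγ (by rw [hk]; exact hcond)).1
  have hcol : ∀ j, 0 < InSector.colNorm A j := fun j =>
    hd.trans_le (InSector.dMin_le_colNorm A j)
  have hlaw : HasLaw (fun ω m => v m ω) (InSector.noiseLaw M (Real.toNNReal (σ ^ 2))) Pr :=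
    iIndepFun.hasLaw_pi hv hindep
  let b : InSector.sectorIndices P → Fin M → ℂ := fun j =>
    ((InSector.colNorm A j)⁻¹ : ℂ) • A.col j
  have hb : ∀ j, ∑ m, ‖b j m‖ ^ 2 = 1 := by
    intro j
    have h1 : ∀ m, ‖b j m‖ ^ 2 = (InSector.colNorm A j ^ 2)⁻¹ * ‖A.col j m‖ ^ 2 := by
      intro m
      simp only [b, Pi.smul_apply, smul_eq_mul, norm_mul, norm_inv, Complex.norm_real,
        Real.norm_of_nonneg (hcol j).le, mul_pow, inv_pow]
    simp only [h1]
    rw [← Finset.mul_sum, ← InSector.l2norm_sq, ← InSector.colNorm]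
    exact inv_mul_cancel₀ (pow_pos (hcol j) 2).ne'
  set B : Set (Fin M → ℂ) := {w | ∀ j, ‖star (b j) ⬝ᵥ w‖ < γ} with hB
  have hBm : MeasurableSet B := by
    have : B = ⋂ j, {w | ‖star (b j) ⬝ᵥ w‖ < γ} := by ext; simp [hB]
    rw [this]
    exact MeasurableSet.iInter fun j => measurableSet_lt (by unfold dotProduct; fun_prop)
      measurable_const
  -- The `v m` are only almost everywhere measurable, so the event is a measurable subset of the
  -- preimage of `B` with the same probability.
  obtain ⟨E, hEsub, hEm, hEae⟩ :=
    (hlaw.aemeasurable.nullMeasurableSet_preimage hBm).exists_measurable_subset_ae_eq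
  have hexp : 2 * N ^ 2 / S = 2 * Fintype.card (InSector.sectorIndices P) := by
    have hS0 : 0 < S := by
      rcases Nat.eq_zero_or_pos S with h | h
      · rw [h, zero_mul] at hS
        exact absurd hS.symm (pow_ne_zero 2 (NeZero.ne N))
      · exact h
    rw [Fintype.card_coe, InSector.card_sectorIndices, ← hS, Nat.mul_left_comm,
      Nat.mul_div_cancel_left _ hS0]
  refine ⟨E, hEm, ?_, fun ω hω Λ xhat hOMP => ?_⟩
  · rw [hexp, measureReal_congr hEae]
    refine (InSector.le_noiseLaw_norm_lt b hb hσ hγ).trans (le_of_eq ?_)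
    exact (hlaw.measureReal_eq (p := fun w => ∀ j, ‖star (b j) ⬝ᵥ w‖ < γ) hBm).symm
  · have hω' : ∀ j, ‖star (b j) ⬝ᵥ fun m => v m ω‖ < γ := hEsub hω
    refine hOMP.eq_supp_and_l2norm_le (w := fun m => v m ω) ?_ hγ hk hcond fun j => ?_
    · rw [hy, hA, hx, InSector.csMatrix_mulVec_vec]
    · have h := hω' j
      rw [star_smul, smul_dotProduct, norm_smul, norm_star, norm_inv, Complex.norm_real,
        Real.norm_of_nonneg (hcol j).le, inv_mul_lt_iff₀ (hcol j)] at h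
      rwa [mul_comm γ]
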